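/- Let $K$ be a field and $n_1\ge 2$. Let $L=L_2(n_1,1)=\{s,x_1,\dots,x_{n_1},y,t\}$ be the finite lattice with least element $s$, greatest element $t$, with $x_1<x_2<\dots<x_{n_1}$, and with $y$ incomparable to every $x_i$. Let $R=K[L]$ be the standard graded polynomial ring whose variables are the elements of $L$, let $$I_L=(\,ab-(a\vee b)(a\wedge b)\;:\;a,b\in L\,)\subset R$$ be the join-meet ideal of $L$, and let $\mathrm{in}_<(I_L)$ be its initial ideal with respect to the (graded) reverse lexicographic order induced by the total order $s<x_1<\dots<x_{n_1}<y<t$ of the variables. Let $$0\leftarrow R/\mathrm{in}_<(I_L)\leftarrow R\leftarrow F_1\leftarrow F_2\leftarrow\cdots,\qquad F_i=\bigoplus_j R(-j)^{B_{i,j}},$$ be a minimal graded free resolution of $R/\mathrm{in}_<(I_L)$. Such a resolution exists, and for every one of them the graded Betti numbers $B_{i,j}$ satisfy $$B_{1,2}=n_1,\qquad B_{1,3}=n_1-1,\qquad B_{2,3}=\binom{n_1}{2},\qquad B_{2,4}=\binom{n_1-1}{2}+n_1-1,$$ and $$\sum_{j\ge 0}B_{1,j}=B_{1,2}+B_{1,3}=2n_1-1,\qquad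 \sum_{j\ge 0}B_{2,j}=B_{2,3}+B_{2,4}=n_1(n_1-1).$$ -/

import Mathlib

open MvPolynomial

/-! ### Crystal lattices -/

/-- The underlying set of the crystal lattice `L_k(n_1, …, n_k)`: a least element `s`, a greatest
element `t`, and `k` disjoint chains `x i 0 < x i 1 < ⋯ < x i (n i - 1)`. The element written
`x_{i,j}` in the literature (with indices starting at 1) is `x (i-1) (j-1)`. -/
inductive CrystalLattice {k : ℕ} (n : Fin k → ℕ) : Type
  | s : CrystalLattice n
  | x (i : Fin k) (a : Fin (n i)) : CrystalLattice n
  | t : CrystalLattice n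

namespace CrystalLattice

variable {k : ℕ} {n : Fin k → ℕ}

/-- The lattice order: `s` is the least element, `t` the greatest one, and elements of the chains
are comparable exactly if they lie on the same chain. -/
protected def le : CrystalLattice n → CrystalLattice n → Prop
  | s, _ => True
  | x _ _, s => False
  | x i a, x j b => i = j ∧ a.val ≤ b.val
  | x _ _, t => True
  | t, t => True
  | t, _ => False

/-- Join. -/
protected def sup : CrystalLattice n → CrystalLattice n → CrystalLattice n
  | s, c => c
  | x i a, s => x i a
  | x i a, x j b => if i = j then (if a.val ≤ b.val then x j b else x i a) else t
  | x _ _, t => t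
  | t, _ => t

/-- Meet. -/
protected def inf : CrystalLattice n → CrystalLattice n → CrystalLattice n
  | s, _ => s
  | x _ _, s => s
  | x i a, x j b => if i = j then (if a.val ≤ b.val then x i a else x j b) else s
  | x i a, t => x i a
  | t, c => c

instance : Lattice (CrystalLattice n) where
  le := CrystalLattice.le
  sup := CrystalLattice.sup
  inf := CrystalLattice.inf
  le_refl a := by cases a <;> simp [CrystalLattice.le]
  le_trans a b c := by
    cases a <;> cases b <;> cases c <;> simp [CrystalLattice.le]
    intro h1 h2 h3 h4
    exact ⟨h1.trans h3, h2.trans h4⟩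
  le_antisymm a b := by
    cases a <;> cases b <;> simp [CrystalLattice.le]
    rename_i i a j b
    rintro rfl h1 - h2
    exact ⟨rfl, heq_of_eq (Fin.ext (le_antisymm h1 h2))⟩
  le_sup_left a b := by
    cases a <;> cases b <;> simp only [CrystalLattice.le, CrystalLattice.sup] <;>
      (try split_ifs) <;> simp_all
  le_sup_right a b := by
    cases a <;> cases b <;> simp only [CrystalLattice.le, CrystalLattice.sup] <;>
      (try split_ifs) <;> simp_all
    omega
  sup_le a b c := by
    cases a <;> cases b <;> cases c <;> simp only [CrystalLattice.le, CrystalLattice.sup] <;>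
      (try split_ifs) <;> simp_all
    intro h1 _ h2
    exact absurd (h1.trans h2.symm) (by assumption)
  inf_le_left a b := by
    cases a <;> cases b <;> simp only [CrystalLattice.le, CrystalLattice.inf] <;>
      (try split_ifs) <;> simp_all
    omega
  inf_le_right a b := by
    cases a <;> cases b <;> simp only [CrystalLattice.le, CrystalLattice.inf] <;>
      (try split_ifs) <;> simp_all
  le_inf a b c := by
    cases a <;> cases b <;> cases c <;> simp only [CrystalLattice.le, CrystalLattice.inf] <;>
      (try split_ifs) <;> simp_all

instance : Finite (CrystalLattice n) := by
  refine Finite.of_surjective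
    (fun o : Option (Option (Σ i : Fin k, Fin (n i))) =>
      match o with
      | none => s
      | some none => t
      | some (some p) => x p.1 p.2) ?_
  rintro (_ | ⟨i, a⟩ | _)
  · exact ⟨none, rfl⟩
  · exact ⟨some (some ⟨i, a⟩), rfl⟩
  · exact ⟨some none, rfl⟩

/-- The position of an element, as a variable, in the total order
`s < x_{1,1} < ⋯ < x_{1,n_1} < x_{2,1} < ⋯ < x_{2,n_2} < ⋯ < x_{k,n_k} < t`
(triples are compared lexicographically). -/
def varKey : CrystalLattice n → ℕ ×ₗ ℕ ×ₗ ℕ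
  | s => toLex (0, toLex (0, 0))
  | x i a => toLex (1, toLex (i.val, a.val))
  | t => toLex (2, toLex (0, 0))

theorem varKey_injective : Function.Injective (varKey (n := n)) := by
  rintro (_ | ⟨i, a⟩ | _) (_ | ⟨j, b⟩ | _) h <;> simp [varKey] at h ⊢
  obtain ⟨h1, h2⟩ := h
  obtain rfl := Fin.ext h1
  exact ⟨rfl, heq_of_eq (Fin.ext h2)⟩

/-- The total order `s < x_{1,1} < ⋯ < x_{1,n_1} < x_{2,1} < ⋯ < x_{k,n_k} < t` on the variables.
It is not the lattice order, hence not an instance. -/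
noncomputable abbrev varOrder (n : Fin k → ℕ) : LinearOrder (CrystalLattice n) :=
  LinearOrder.lift' varKey varKey_injective

end CrystalLattice

/-! ### Join-meet ideals -/

/-- The join-meet ideal of a lattice `L`: the ideal of `K[L]` generated by all
`a b - (a ∨ b) (a ∧ b)` with `a, b ∈ L`. -/
noncomputable def joinMeetIdeal (K : Type*) [Field K] (L : Type*) [Lattice L] : Ideal (MvPolynomial L K) :=
  Ideal.span {f | ∃ a b : L, f = X a * X b - X (a ⊔ b) * X (a ⊓ b)}

/-! ### The reverse lexicographic order and initial ideals -/

/-- Exponent vectors, to be ordered by the (graded) reverse lexicographic order. -/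
def DegRevLex (σ : Type*) : Type _ := σ →₀ ℕ

namespace DegRevLex

variable {σ : Type*}

noncomputable instance : AddCommMonoid (DegRevLex σ) := inferInstanceAs (AddCommMonoid (σ →₀ ℕ))

/-- The identity, as an additive equivalence. -/
noncomputable def ofFinsupp : (σ →₀ ℕ) ≃+ DegRevLex σ := AddEquiv.refl (σ →₀ ℕ)

/-- `a` is compared with `b` first by total degree; for equal degrees, `a` is smaller than `b` iff
at the smallest variable at which they differ `a` has the larger exponent (that is,
`b` is lexicographically smaller than `a`, reading the exponents from the smallest variable on). -/
noncomputable def key (a : DegRevLex σ) : ℕ ×ₗ (Lex (σ →₀ ℕ))ᵒᵈ :=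
  toLex ((ofFinsupp.symm a).degree, OrderDual.toDual (toLex (ofFinsupp.symm a)))

theorem key_injective : Function.Injective (key (σ := σ)) := by
  intro a b h
  have h2 := congrArg (fun z => ofLex (OrderDual.ofDual (ofLex z).2)) h
  exact ofFinsupp.symm.injective h2

variable [LinearOrder σ]

noncomputable instance : LinearOrder (DegRevLex σ) := LinearOrder.lift' key key_injective

theorem lt_iff {a b : σ →₀ ℕ} :
    ofFinsupp a < ofFinsupp b ↔ a.degree < b.degree ∨
      a.degree = b.degree ∧ ∃ i, (∀ j, j < i → a j = b j) ∧ b i < a i := by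
  have h : ofFinsupp a < ofFinsupp b ↔ key (ofFinsupp a) < key (ofFinsupp b) := Iff.rfl
  have h2 : toLex b < toLex a ↔ ∃ i, (∀ j, j < i → b j = a j) ∧ b i < a i :=
    Finsupp.lex_def
  rw [h, key, key, Prod.Lex.toLex_lt_toLex]
  simp only [AddEquiv.symm_apply_apply, OrderDual.toDual_lt_toDual, h2, eq_comm]

theorem le_iff {a b : σ →₀ ℕ} :
    ofFinsupp a ≤ ofFinsupp b ↔ a.degree < b.degree ∨
      a.degree = b.degree ∧ toLex b ≤ toLex a := by
  have h : ofFinsupp a ≤ ofFinsupp b ↔ key (ofFinsupp a) ≤ key (ofFinsupp b) := Iff.rfl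
  rw [h, key, key, Prod.Lex.toLex_le_toLex]
  simp only [AddEquiv.symm_apply_apply, OrderDual.toDual_le_toDual]

instance : IsOrderedAddMonoid (DegRevLex σ) where
  add_le_add_left a b h c := by
    obtain ⟨a, rfl⟩ := ofFinsupp.surjective a
    obtain ⟨b, rfl⟩ := ofFinsupp.surjective b
    obtain ⟨c, rfl⟩ := ofFinsupp.surjective c
    rw [← map_add, ← map_add]
    rw [le_iff] at h ⊢
    simpa [map_add, toLex_add] using h

instance [Finite σ] : WellFoundedLT (DegRevLex σ) where
  wf := by
    have hfin : ∀ d : ℕ, {a : σ →₀ ℕ | a.degree = d}.Finite := by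
      intro d
      have := Fintype.ofFinite σ
      refine (Set.Finite.subset (Set.finite_Iic (Finsupp.equivFunOnFinite.symm fun _ : σ => d)) ?_)
      intro a ha i
      rw [Set.mem_ofPred_eq] at ha
      simpa [← ha] using Finsupp.le_degree i a
    refine WellFounded.intro fun a => ?_
    have key1 : ∀ d : ℕ, ∀ a : DegRevLex σ, (ofFinsupp.symm a).degree = d → Acc (· < ·) a := by
      intro d
      induction d using Nat.strong_induction_on with
      | _ d ih =>
        have hf : (ofFinsupp '' {a : σ →₀ ℕ | a.degree = d}).Finite := (hfin d).image _
        have hwf := hf.wellFoundedOn (r := (· < · : DegRevLex σ → DegRevLex σ → Prop))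
        intro a ha
        refine hwf.induction (P := fun a => Acc (· < ·) a)
          ⟨ofFinsupp.symm a, ha, ofFinsupp.apply_symm_apply a⟩ ?_
        rintro _ ⟨b, hb, rfl⟩ hind
        refine Acc.intro _ fun c hc => ?_
        obtain ⟨c, rfl⟩ := ofFinsupp.surjective c
        rcases lt_iff.1 hc with h | ⟨h, -⟩
        · exact ih c.degree (h.trans_eq hb) _ (by simp)
        · exact hind _ ⟨c, h.trans hb, rfl⟩ hc
    exact key1 _ a rfl

end DegRevLex

/-- The (graded) reverse lexicographic order induced by a total order on the finite set of
variables. -/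
noncomputable def degRevLex (σ : Type*) [LinearOrder σ] [Finite σ] : MonomialOrder σ where
  syn := DegRevLex σ
  toSyn := DegRevLex.ofFinsupp
  toSyn_monotone a b h := by
    rw [DegRevLex.le_iff]
    rcases (Finsupp.degree_mono h).lt_or_eq with h1 | h1
    · exact Or.inl h1
    · refine Or.inr ⟨h1, ?_⟩
      obtain ⟨c, rfl⟩ := exists_add_of_le h
      have hc : c = 0 := (Finsupp.degree_eq_zero_iff c).1 (by simpa using h1)
      simp [hc]

/-- The initial ideal of `I`: the ideal generated by the leading terms of the elements of `I`. -/
noncomputable def initialIdeal {σ K : Type*} [Field K] (m : MonomialOrder σ)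
    (I : Ideal (MvPolynomial σ K)) : Ideal (MvPolynomial σ K) :=
  Ideal.span (m.leadingTerm '' (I : Set (MvPolynomial σ K)))

/-- The initial ideal `in_<(I_L)` of the join-meet ideal of the crystal lattice
`L = L_k(n_1, …, n_k)` with respect to the reverse lexicographic order induced by
`s < x_{1,1} < ⋯ < x_{1,n_1} < ⋯ < x_{k,1} < ⋯ < x_{k,n_k} < t`. -/
noncomputable def crystalInitialIdeal (K : Type*) [Field K] {k : ℕ} (n : Fin k → ℕ) :
    Ideal (MvPolynomial (CrystalLattice n) K) :=
  initialIdeal (@degRevLex (CrystalLattice n) (CrystalLattice.varOrder n) inferInstance)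
    (joinMeetIdeal K (CrystalLattice n))

/-! ### Minimal graded free resolutions and graded Betti numbers -/

/-- A minimal graded free resolution `0 ← R/J ← R ← F_1 ← F_2 ← ⋯` of `R/J` over the standard graded
polynomial ring `R`, with `F_i = ⨁_p R(-shift i p)` of finite rank, given with homogeneous bases.
Here `J` is a proper homogeneous ideal. A resolution of finite length `ℓ` is the case in which
`rank i = 0` for `i > ℓ`. -/
structure MinimalGradedFreeResolution {σ K : Type*} [Field K] (J : Ideal (MvPolynomial σ K)) where
  /-- The rank of `F_i`. -/
  rank : ℕ → ℕ
  /-- The degrees of the basis elements of `F_i`. -/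
  shift : (i : ℕ) → Fin (rank i) → ℕ
  /-- The differential `F_{i+1} → F_i`. -/
  d : (i : ℕ) →
    (Fin (rank (i + 1)) → MvPolynomial σ K) →ₗ[MvPolynomial σ K] (Fin (rank i) → MvPolynomial σ K)
  /-- `F_0 = R(0)`. -/
  rank_zero : rank 0 = 1
  shift_zero : ∀ p, shift 0 p = 0
  /-- The image of `F_1 → F_0 = R` is `J`, so that the cokernel is `R/J`. -/
  range_d_zero : ∀ v, v ∈ LinearMap.range (d 0) ↔ ∀ p, v p ∈ J
  /-- Exactness at `F_{i+1}`. -/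
  exact : ∀ i, Function.Exact (d (i + 1)) (d i)
  /-- The differentials are homogeneous of degree 0: the `(p, q)` entry is homogeneous of degree
  `shift (i + 1) q - shift i p` (in particular it is 0 if this number is negative). -/
  homogeneous : ∀ i q p, ∀ u ∈ (d i (Pi.single q 1) p).support,
    u.degree + shift i p = shift (i + 1) q
  /-- Minimality: the entries lie in the ideal generated by the variables, that is,
  the image of `F_{i+1}` lies in `𝔪 F_i`. -/
  minimal : ∀ i q p, constantCoeff (d i (Pi.single q 1) p) = 0

/-- The graded Betti number `B_{i,j}` read off from a minimal graded free resolution: the number of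
summands `R(-j)` of `F_i`. -/
def MinimalGradedFreeResolution.betti {σ K : Type*} [Field K] {J : Ideal (MvPolynomial σ K)}
    (F : MinimalGradedFreeResolution J) (i j : ℕ) : ℕ :=
  (Finset.univ.filter fun p : Fin (F.rank i) => F.shift i p = j).card

/-!
For `L = L_2(n, 1)` the join-meet ideal is generated by the binomials `x_i y - s t`, since all other
pairs are comparable. Its initial ideal is `J = (x_1 y, …, x_n y, s t x_2, …, s t x_n)`
(`TwoChain.crystalInitialIdeal_eq`). The generators are leading terms of `x_i y - s t` and of
`s t x_j - s t x_1`. That there are no others is seen without Buchberger's algorithm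
(`TwoChain.exists_le_degree`): a monomial outside `J` is the least one in its class modulo the
replacements `x_i y ↔ s t`, and adding up the coefficients over such a class is a linear functional that
vanishes on the join-meet ideal, so that the monomial cannot be a leading one.

The syzygies of `J` are generated by the Koszul relations between the `x_i`, within each of the two
families of generators, and by `y · (s t x_j) = s t · (x_j y)` for `j ≥ 2`
(`GradedFree.exact_syzygyMap_generatorMap`). This follows from the fact that the syzygies of distinct
variables are the Koszul ones, applied first to `y, x_2, …, x_n` and then to `x_1, …, x_n`. No
relation between these syzygies has a unit coefficient, so they form a minimal system: there are
`n.choose 2` of them in degree 3, and `(n - 1).choose 2 + (n - 1)` in degree 4.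

Any two minimal graded free resolutions have the same Betti numbers. For the first two steps this is
`GradedFree.card_shift_le_of_presentation` and `GradedFree.card_shift_le_of_resolution`, which need
only the beginning of the resolutions: comparison maps in both directions compose to the identity up
to homotopy, hence to the identity modulo the variables. So the counts above hold for every
resolution. A resolution exists by Noetherianity, with a smallest possible homogeneous generating set of
the syzygies at each step (`GradedFree.nonempty_minimalGradedFreeResolution`).
-/

/-! ### Graded free modules over a polynomial ring -/

namespace GradedFree

variable {σ K : Type*} [Field K] {ι κ ι' ι₁ κ₁ : Type*}

/-- The vector `v` is homogeneous of degree `e` in the graded free module `⨁_p R(-a p)`, `R = K[σ]`.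
The zero vector is homogeneous of every degree. -/
def IsHomogeneousVec (a : ι → ℕ) (e : ℕ) (v : ι → MvPolynomial σ K) : Prop :=
  ∀ p, ∀ u ∈ (v p).support, u.degree + a p = e

/-- `f` is a homogeneous map `⨁_q R(-a q) → ⨁_p R(-b p)` of degree 0. -/
def IsHomogeneousMap [DecidableEq ι] (a : ι → ℕ) (b : κ → ℕ)
    (f : (ι → MvPolynomial σ K) →ₗ[MvPolynomial σ K] (κ → MvPolynomial σ K)) : Prop :=
  ∀ q, IsHomogeneousVec b (a q) (f (Pi.single q 1))

/-- `v` lies in `𝔪 F`, where `𝔪` is the ideal generated by the variables and `F = ι → R`. -/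
def IsMinimalVec (v : ι → MvPolynomial σ K) : Prop := ∀ p, constantCoeff (v p) = 0

/-- The component of degree `e` of a vector of `⨁_p R(-a p)`. -/
noncomputable def component (a : ι → ℕ) (e : ℕ) (v : ι → MvPolynomial σ K) :
    ι → MvPolynomial σ K :=
  fun p => if a p ≤ e then homogeneousComponent (e - a p) (v p) else 0

theorem coeff_component (a : ι → ℕ) (e : ℕ) (v : ι → MvPolynomial σ K) (p : ι) (u : σ →₀ ℕ) :
    coeff u (component a e v p) = if u.degree + a p = e then coeff u (v p) else 0 := by
  unfold component
  split_ifs with h1 h2 h2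
  · rw [coeff_homogeneousComponent, if_pos (by omega)]
  · rw [coeff_homogeneousComponent, if_neg (by omega)]
  · omega
  · simp

theorem isHomogeneousVec_component (a : ι → ℕ) (e : ℕ) (v : ι → MvPolynomial σ K) :
    IsHomogeneousVec a e (component a e v) := by
  intro p u hu
  rw [mem_support_iff, coeff_component] at hu
  by_contra h
  exact hu (if_neg h)

theorem IsHomogeneousVec.component_eq {a : ι → ℕ} {e : ℕ} {v : ι → MvPolynomial σ K}
    (h : IsHomogeneousVec a e v) : component a e v = v := by
  ext p u
  rw [coeff_component, ite_eq_left_iff]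
  intro hu
  by_contra h0
  exact hu (h p u (mem_support_iff.2 (Ne.symm h0)))

theorem component_sum {α : Type*} (s : Finset α) (a : ι → ℕ) (e : ℕ)
    (v : α → ι → MvPolynomial σ K) :
    component a e (∑ i ∈ s, v i) = ∑ i ∈ s, component a e (v i) := by
  ext p u
  simp only [coeff_component, Finset.sum_apply, coeff_sum]
  split_ifs <;> simp

theorem IsHomogeneousVec.sub {a : ι → ℕ} {e : ℕ} {v w : ι → MvPolynomial σ K}
    (hv : IsHomogeneousVec a e v) (hw : IsHomogeneousVec a e w) :
    IsHomogeneousVec a e (v - w) := by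
  classical
  intro p u hu
  rcases Finset.mem_union.1 (support_sub σ (v p) (w p) hu) with h | h
  · exact hv p u h
  · exact hw p u h

theorem isHomogeneousVec_single [DecidableEq ι] (a : ι → ℕ) (q : ι) :
    IsHomogeneousVec a (a q) (Pi.single q 1 : ι → MvPolynomial σ K) := by
  intro p u hu
  by_cases h : p = q
  · subst h
    classical
    rw [Pi.single_eq_same, mem_support_iff, coeff_one] at hu
    have : u = 0 := by by_contra h; exact hu (if_neg (Ne.symm h))
    simp [this]
  · simp [Pi.single_eq_of_ne h] at hu

theorem component_smul {a : ι → ℕ} {b : κ → ℕ} (e : ℕ) (v : ι → MvPolynomial σ K) {q : ι}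
    {w : κ → MvPolynomial σ K} (hw : IsHomogeneousVec b (a q) w) :
    component b e (v q • w) = component a e v q • w := by
  classical
  ext p u
  rw [coeff_component, Pi.smul_apply, Pi.smul_apply, smul_eq_mul, smul_eq_mul, coeff_mul, coeff_mul]
  trans ∑ x ∈ Finset.HasAntidiagonal.antidiagonal u,
      if u.degree + b p = e then coeff x.1 (v q) * coeff x.2 (w p) else 0
  · split_ifs <;> simp
  refine Finset.sum_congr rfl fun x hx => ?_
  rw [coeff_component]
  by_cases h0 : coeff x.2 (w p) = 0
  · simp [h0]
  · have h1 := hw p x.2 (mem_support_iff.2 h0)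
    have h2 : u.degree = x.1.degree + x.2.degree := by
      rw [← Finset.HasAntidiagonal.mem_antidiagonal.1 hx, map_add]
    have h3 : u.degree + b p = e ↔ x.1.degree + a q = e := by omega
    simp only [h3, ite_mul, zero_mul]

section
variable [Fintype ι] [DecidableEq ι]

theorem map_eq_sum_single
    (f : (ι → MvPolynomial σ K) →ₗ[MvPolynomial σ K] (κ → MvPolynomial σ K))
    (v : ι → MvPolynomial σ K) : f v = ∑ q, v q • f (Pi.single q 1) := by
  conv_lhs => rw [pi_eq_sum_univ' v]
  simp only [map_sum, map_smul]

theorem IsHomogeneousMap.map_component {a : ι → ℕ} {b : κ → ℕ}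
    {f : (ι → MvPolynomial σ K) →ₗ[MvPolynomial σ K] (κ → MvPolynomial σ K)}
    (hf : IsHomogeneousMap a b f) (e : ℕ) (v : ι → MvPolynomial σ K) :
    f (component a e v) = component b e (f v) := by
  rw [map_eq_sum_single f v, map_eq_sum_single f (component a e v), component_sum]
  exact Finset.sum_congr rfl fun q _ => (component_smul e v (hf q)).symm

theorem IsHomogeneousMap.map_vec {a : ι → ℕ} {b : κ → ℕ}
    {f : (ι → MvPolynomial σ K) →ₗ[MvPolynomial σ K] (κ → MvPolynomial σ K)}
    (hf : IsHomogeneousMap a b f) {e : ℕ} {v : ι → MvPolynomial σ K}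
    (hv : IsHomogeneousVec a e v) : IsHomogeneousVec b e (f v) := by
  rw [← hv.component_eq, hf.map_component]
  exact isHomogeneousVec_component _ _ _

/-- Free modules are graded projective: a homogeneous map whose image lies in the image of the
homogeneous map `f` factors through `f` by a homogeneous map. -/
theorem exists_homogeneous_lift [Fintype ι'] [DecidableEq ι'] {a : ι → ℕ} {b : κ → ℕ} {a' : ι' → ℕ}
    {f : (ι → MvPolynomial σ K) →ₗ[MvPolynomial σ K] (κ → MvPolynomial σ K)}
    {g : (ι' → MvPolynomial σ K) →ₗ[MvPolynomial σ K] (κ → MvPolynomial σ K)}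
    (hf : IsHomogeneousMap a b f) (hg : IsHomogeneousMap a' b g)
    (h : ∀ q, g (Pi.single q 1) ∈ LinearMap.range f) :
    ∃ φ : (ι' → MvPolynomial σ K) →ₗ[MvPolynomial σ K] (ι → MvPolynomial σ K),
      IsHomogeneousMap a' a φ ∧ f ∘ₗ φ = g := by
  choose w hw using h
  refine ⟨Fintype.linearCombination _ fun q => component a (a' q) (w q), fun q => ?_, ?_⟩
  · rw [Fintype.linearCombination_apply_single, one_smul]
    exact isHomogeneousVec_component _ _ _
  · refine LinearMap.pi_ext' fun q => LinearMap.ext_ring ?_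
    simp only [LinearMap.comp_apply, LinearMap.single_apply]
    rw [Fintype.linearCombination_apply_single, one_smul, hf.map_component, hw,
      (hg q).component_eq]

theorem isMinimalVec_map {f : (ι → MvPolynomial σ K) →ₗ[MvPolynomial σ K] (κ → MvPolynomial σ K)}
    {v : ι → MvPolynomial σ K} (hv : IsMinimalVec v) : IsMinimalVec (f v) := by
  intro p
  rw [map_eq_sum_single f v]
  simp [Finset.sum_apply, hv _]

/-- If `ψ ∘ φ` is the identity modulo `𝔪`, then `φ` is injective modulo `𝔪` on the span of the basis
elements of each degree `j`; hence the source has at most as many of them as the target. -/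
theorem card_shift_le [Fintype κ] [DecidableEq κ] {a : ι → ℕ} {b : κ → ℕ}
    {φ : (ι → MvPolynomial σ K) →ₗ[MvPolynomial σ K] (κ → MvPolynomial σ K)}
    {ψ : (κ → MvPolynomial σ K) →ₗ[MvPolynomial σ K] (ι → MvPolynomial σ K)}
    (hφ : IsHomogeneousMap a b φ)
    (h : ∀ v, IsMinimalVec (ψ (φ v) - v)) (j : ℕ) :
    (Finset.univ.filter fun q => a q = j).card ≤ (Finset.univ.filter fun p => b p = j).card := by
  let A : Matrix {p // b p = j} {q // a q = j} K :=
    fun p q => constantCoeff (φ (Pi.single q.1 1) p.1)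
  let B : Matrix {q // a q = j} {p // b p = j} K :=
    fun q p => constantCoeff (ψ (Pi.single p.1 1) q.1)
  have hBA : B * A = 1 := by
    ext q q'
    have h1 := h (Pi.single q'.1 1) q.1
    rw [map_eq_sum_single ψ, Pi.sub_apply] at h1
    simp only [Finset.sum_apply, Pi.smul_apply, smul_eq_mul, map_sub, map_sum,
      map_mul, sub_eq_zero] at h1
    have h3 : (B * A) q q' = ∑ p : κ, constantCoeff (φ (Pi.single q'.1 1) p) *
        constantCoeff (ψ (Pi.single p 1) q.1) := by
      rw [← Finset.sum_subset (Finset.subset_univ (Finset.univ.filter fun p => b p = j)),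
        Finset.sum_subtype (p := fun p => b p = j) _ (by simp)]
      · exact Finset.sum_congr rfl fun p _ => mul_comm _ _
      · intro p _ hp
        rw [mul_eq_zero]
        left
        -- a nonzero constant entry of a homogeneous map joins basis elements of equal degree
        by_contra h0
        have := hφ q'.1 p 0 (mem_support_iff.2 h0)
        rw [q'.2] at this
        simp_all
    rw [h3, h1, Matrix.one_apply]
    by_cases hq : q = q'
    · simp [hq]
    · have : q.1 ≠ q'.1 := fun h => hq (Subtype.ext h)
      simp [hq, Pi.single_eq_of_ne this]
  have hinj : Function.Injective A.mulVec := by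
    intro v w hvw
    have := congrArg B.mulVec hvw
    simpa [Matrix.mulVec_mulVec, hBA] using this
  have := LinearMap.finrank_le_finrank_of_injective (f := A.mulVecLin) hinj
  simpa [Module.finrank_fintype_fun_eq_card, Fintype.card_subtype] using this

end

theorem IsHomogeneousMap.comp {ρ : Type*} [DecidableEq ι] [Fintype κ] [DecidableEq κ] {a : ι → ℕ} {b : κ → ℕ}
    {c : ρ → ℕ}
    {f : (ι → MvPolynomial σ K) →ₗ[MvPolynomial σ K] (κ → MvPolynomial σ K)}
    {g : (κ → MvPolynomial σ K) →ₗ[MvPolynomial σ K] (ρ → MvPolynomial σ K)}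
    (hg : IsHomogeneousMap b c g) (hf : IsHomogeneousMap a b f) :
    IsHomogeneousMap a c (g ∘ₗ f) :=
  fun q => hg.map_vec (hf q)

/-! ### Comparison of minimal presentations -/

section
variable [Fintype ι] [DecidableEq ι]

/-- The degrees of the minimal generators of the common image: only the minimality of `f` is needed
for the inequality. -/
theorem card_shift_le_of_presentation [Fintype κ] [DecidableEq κ] {ρ : Type*} {a : ι → ℕ}
    {b : κ → ℕ} {c : ρ → ℕ}
    {f : (ι → MvPolynomial σ K) →ₗ[MvPolynomial σ K] (ρ → MvPolynomial σ K)}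
    {g : (κ → MvPolynomial σ K) →ₗ[MvPolynomial σ K] (ρ → MvPolynomial σ K)}
    (hf : IsHomogeneousMap a c f) (hg : IsHomogeneousMap b c g)
    (hr : LinearMap.range f = LinearMap.range g) (hmin : ∀ v, f v = 0 → IsMinimalVec v) (j : ℕ) :
    (Finset.univ.filter fun q => a q = j).card ≤ (Finset.univ.filter fun p => b p = j).card := by
  obtain ⟨φ, hφ, hgφ⟩ := exists_homogeneous_lift hg hf fun q => hr ▸ LinearMap.mem_range_self f _
  obtain ⟨ψ, hψ, hfψ⟩ := exists_homogeneous_lift hf hg fun q => hr ▸ LinearMap.mem_range_self g _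
  refine card_shift_le hφ (ψ := ψ) (fun v => hmin _ ?_) j
  have h1 := LinearMap.congr_fun hfψ (φ v)
  have h2 := LinearMap.congr_fun hgφ v
  simp only [LinearMap.comp_apply] at h1 h2
  rw [map_sub, h1, h2, sub_self]

/-- The degrees of the minimal first syzygies of the common image. The comparison maps `φ`, `φ₁` and
`ψ`, `ψ₁` lift the identity, and a homotopy `h` with `f₁ ∘ h = ψ ∘ φ - 1` gives
`f₁ ∘ (ψ₁ ∘ φ₁ - 1 - h ∘ f₁) = 0`; as both `ker f₁` and the image of `f₁` are contained in `𝔪` times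
the free module, `ψ₁ ∘ φ₁` is the identity modulo `𝔪`. -/
theorem card_shift_le_of_resolution {ρ : Type*}
    [Fintype κ] [DecidableEq κ] [Fintype ι₁] [DecidableEq ι₁] [Fintype κ₁] [DecidableEq κ₁]
    {a : ι → ℕ} {b : κ → ℕ} {a₁ : ι₁ → ℕ} {b₁ : κ₁ → ℕ} {c : ρ → ℕ}
    {f₁ : (ι₁ → MvPolynomial σ K) →ₗ[MvPolynomial σ K] (ι → MvPolynomial σ K)}
    {f : (ι → MvPolynomial σ K) →ₗ[MvPolynomial σ K] (ρ → MvPolynomial σ K)}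
    {g₁ : (κ₁ → MvPolynomial σ K) →ₗ[MvPolynomial σ K] (κ → MvPolynomial σ K)}
    {g : (κ → MvPolynomial σ K) →ₗ[MvPolynomial σ K] (ρ → MvPolynomial σ K)}
    (hf₁ : IsHomogeneousMap a₁ a f₁) (hf : IsHomogeneousMap a c f)
    (hg₁ : IsHomogeneousMap b₁ b g₁) (hg : IsHomogeneousMap b c g)
    (hfe : Function.Exact f₁ f) (hge : Function.Exact g₁ g)
    (hr : LinearMap.range f = LinearMap.range g)
    (hf₁min : ∀ v, IsMinimalVec (f₁ v)) (hmin : ∀ v, f₁ v = 0 → IsMinimalVec v) (j : ℕ) :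
    (Finset.univ.filter fun q => a₁ q = j).card ≤
      (Finset.univ.filter fun p => b₁ p = j).card := by
  obtain ⟨φ, hφ, hgφ⟩ := exists_homogeneous_lift hg hf fun q => hr ▸ LinearMap.mem_range_self f _
  obtain ⟨ψ, hψ, hfψ⟩ := exists_homogeneous_lift hf hg fun q => hr ▸ LinearMap.mem_range_self g _
  replace hgφ := fun v => LinearMap.congr_fun hgφ v
  replace hfψ := fun v => LinearMap.congr_fun hfψ v
  simp only [LinearMap.comp_apply] at hgφ hfψ
  obtain ⟨φ₁, hφ₁, hgφ₁⟩ := exists_homogeneous_lift hg₁ (hφ.comp hf₁) fun q => by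
    rw [LinearMap.mem_range, ← Set.mem_range, ← hge]
    exact (hgφ _).trans ((hfe _).2 ⟨_, rfl⟩)
  obtain ⟨ψ₁, hψ₁, hfψ₁⟩ := exists_homogeneous_lift hf₁ (hψ.comp hg₁) fun q => by
    rw [LinearMap.mem_range, ← Set.mem_range, ← hfe]
    exact (hfψ _).trans ((hge _).2 ⟨_, rfl⟩)
  obtain ⟨h, -, hh⟩ := exists_homogeneous_lift (g := ψ ∘ₗ φ - LinearMap.id) hf₁
      (fun q => (hψ.comp hφ q).sub (isHomogeneousVec_single a q)) fun q => by
    rw [LinearMap.mem_range, ← Set.mem_range, ← hfe]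
    simp [hfψ, hgφ]
  replace hgφ₁ := fun v => LinearMap.congr_fun hgφ₁ v
  replace hfψ₁ := fun v => LinearMap.congr_fun hfψ₁ v
  replace hh := fun v => LinearMap.congr_fun hh v
  simp only [LinearMap.comp_apply, LinearMap.sub_apply, LinearMap.id_apply] at hgφ₁ hfψ₁ hh
  refine card_shift_le hφ₁ (ψ := ψ₁) (fun v => ?_) j
  have h1 : IsMinimalVec (ψ₁ (φ₁ v) - v - h (f₁ v)) := by
    refine hmin _ ?_
    rw [map_sub, map_sub, hfψ₁, hgφ₁, hh, sub_self]
  have h2 : IsMinimalVec (h (f₁ v)) := isMinimalVec_map (hf₁min v)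
  intro p
  have := h1 p
  rw [Pi.sub_apply, map_sub, h2 p, sub_zero] at this
  exact this

end

/-! ### Existence of minimal graded free resolutions -/

theorem exists_sum_component [Fintype ι] (a : ι → ℕ) (v : ι → MvPolynomial σ K) :
    ∃ T : Finset ℕ, ∑ e ∈ T, component a e v = v := by
  classical
  refine ⟨Finset.univ.biUnion fun p => (v p).support.image fun u => u.degree + a p, ?_⟩
  ext p u
  rw [Finset.sum_apply, coeff_sum]
  simp only [coeff_component]
  rw [Finset.sum_ite_eq, ite_eq_left_iff]
  intro h
  by_contra h0
  exact h (Finset.mem_biUnion.2 ⟨p, Finset.mem_univ p,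
    Finset.mem_image_of_mem _ (mem_support_iff.2 (Ne.symm h0))⟩)

variable [Finite σ]

/-- `M` is a graded submodule of `⨁_p R(-a p)`: it contains the components of its elements. -/
def IsGraded (a : ι → ℕ)
    (M : Submodule (MvPolynomial σ K) (ι → MvPolynomial σ K)) : Prop :=
  ∀ v ∈ M, ∀ e, component a e v ∈ M

theorem IsGraded.exists_generators [Fintype ι] {a : ι → ℕ}
    {M : Submodule (MvPolynomial σ K) (ι → MvPolynomial σ K)} (hM : IsGraded a M) :
    ∃ (k : ℕ) (b : Fin k → ℕ) (g : Fin k → ι → MvPolynomial σ K),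
      (∀ q, IsHomogeneousVec a (b q) (g q)) ∧
      Submodule.span (MvPolynomial σ K) (Set.range g) = M := by
  classical
  obtain ⟨S, hS⟩ := IsNoetherian.noetherian M
  choose T hT using exists_sum_component (σ := σ) (K := K) a
  let S' : Finset (ι → MvPolynomial σ K) := S.biUnion fun v => (T v).image fun e => component a e v
  have hS' : ∀ w ∈ S', ∃ v ∈ S, ∃ e ∈ T v, component a e v = w := by
    intro w hw
    simpa [S'] using hw
  have hdeg : ∀ w : S', ∃ e, IsHomogeneousVec a e w.1 := by
    rintro ⟨w, hw⟩
    obtain ⟨v, -, e, -, rfl⟩ := hS' w hw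
    exact ⟨e, isHomogeneousVec_component _ _ _⟩
  choose b hb using hdeg
  refine ⟨_, fun q => b (S'.equivFin.symm q), fun q => (S'.equivFin.symm q).1, fun q => hb _, ?_⟩
  have hrange : (Set.range fun q => (S'.equivFin.symm q).1) = (S' : Set (ι → MvPolynomial σ K)) := by
    rw [show (fun q => (S'.equivFin.symm q).1) = Subtype.val ∘ S'.equivFin.symm from rfl,
      Set.range_comp, S'.equivFin.symm.surjective.range_eq, Set.image_univ, Subtype.range_coe]
  rw [hrange]
  refine le_antisymm (Submodule.span_le.2 fun w hw => ?_) (hS ▸ Submodule.span_le.2 fun v hv => ?_)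
  · obtain ⟨v, hv, e, -, rfl⟩ := hS' w hw
    exact hM v (hS ▸ Submodule.subset_span hv) e
  · rw [← hT v]
    refine Submodule.sum_mem _ fun e he => Submodule.subset_span ?_
    exact Finset.mem_biUnion.2 ⟨v, hv, Finset.mem_image_of_mem _ he⟩

/-- A graded submodule is covered by a free module on as few homogeneous generators as possible.
If a relation between them had a unit coefficient, one generator would be redundant, so the kernel
is contained in `𝔪` times the free module. -/
theorem IsGraded.exists_minimal_cover [Fintype ι] {a : ι → ℕ}
    {M : Submodule (MvPolynomial σ K) (ι → MvPolynomial σ K)} (hM : IsGraded a M) :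
    ∃ (k : ℕ) (b : Fin k → ℕ)
      (f : (Fin k → MvPolynomial σ K) →ₗ[MvPolynomial σ K] (ι → MvPolynomial σ K)),
      IsHomogeneousMap b a f ∧ LinearMap.range f = M ∧ IsGraded b (LinearMap.ker f) ∧
      ∀ v ∈ LinearMap.ker f, IsMinimalVec v := by
  classical
  have hex := hM.exists_generators
  obtain ⟨b, g, hg, hspan⟩ := Nat.find_spec hex
  have hmin := fun m (hm : m < Nat.find hex) => Nat.find_min hex hm
  generalize Nat.find hex = k at b g hg hspan hmin
  have hf : IsHomogeneousMap b a (Fintype.linearCombination (MvPolynomial σ K) g) := by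
    intro q
    rw [Fintype.linearCombination_apply_single, one_smul]
    exact hg q
  have hker : IsGraded b (LinearMap.ker (Fintype.linearCombination (MvPolynomial σ K) g)) := by
    intro v hv e
    rw [LinearMap.mem_ker] at hv ⊢
    rw [hf.map_component, hv]
    ext p u
    simp [coeff_component]
  refine ⟨k, b, Fintype.linearCombination _ g, hf, ?_, hker, fun v hv q => ?_⟩
  · rw [Fintype.range_linearCombination, hspan]
  · by_contra hc
    obtain _ | k := k
    · exact q.elim0
    -- the component of degree `b q` of the relation `v` has the nonzero constant
    -- `constantCoeff (v q)` at `q`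
    have hw := hker v hv (b q)
    rw [LinearMap.mem_ker, Fintype.linearCombination_apply, Fin.sum_univ_succAbove _ q] at hw
    have hwq : component b (b q) v q = C (constantCoeff (v q)) := by
      simp [component, constantCoeff_eq]
    rw [hwq, add_eq_zero_iff_eq_neg] at hw
    refine hmin k (Nat.lt_succ_self k) ⟨fun i => b (q.succAbove i), fun i => g (q.succAbove i),
      fun i => hg _, ?_⟩
    rw [← hspan]
    refine le_antisymm (Submodule.span_mono ?_) (Submodule.span_le.2 ?_)
    · rintro _ ⟨i, rfl⟩
      exact ⟨_, rfl⟩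
    · have hsucc : ∀ i, g (q.succAbove i) ∈ Submodule.span (MvPolynomial σ K)
          (Set.range fun i => g (q.succAbove i)) := fun i => Submodule.subset_span ⟨i, rfl⟩
      rintro _ ⟨i, rfl⟩
      induction i using Fin.succAboveCases q with
      | x =>
        have : g q = (C (constantCoeff (v q))⁻¹ : MvPolynomial σ K) •
            ((C (constantCoeff (v q)) : MvPolynomial σ K) • g q) := by
          rw [smul_smul, ← C_mul, inv_mul_cancel₀ hc, C_1, one_smul]
        rw [SetLike.mem_coe, this, hw]
        exact Submodule.smul_mem _ _ (Submodule.neg_mem _ (Submodule.sum_mem _ fun i _ =>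
          Submodule.smul_mem _ _ (hsucc i)))
      | p i => exact hsucc i

/-- A graded submodule of a graded free module `F` that is contained in `𝔪 F`: the module of syzygies
from which a minimal graded free resolution is continued. -/
structure MinimalGradedSubmodule (σ K : Type*) [Field K] where
  /-- The rank of the ambient free module `F`. -/
  rank : ℕ
  /-- The degrees of the basis elements of `F`. -/
  shift : Fin rank → ℕ
  /-- The submodule. -/
  carrier : Submodule (MvPolynomial σ K) (Fin rank → MvPolynomial σ K)
  graded : IsGraded shift carrier
  minimal : ∀ v ∈ carrier, IsMinimalVec v

theorem MinimalGradedSubmodule.exists_next (S : MinimalGradedSubmodule σ K) :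
    ∃ (T : MinimalGradedSubmodule σ K)
      (f : (Fin T.rank → MvPolynomial σ K) →ₗ[MvPolynomial σ K] (Fin S.rank → MvPolynomial σ K)),
      IsHomogeneousMap T.shift S.shift f ∧ LinearMap.range f = S.carrier ∧
      LinearMap.ker f = T.carrier := by
  obtain ⟨k, b, f, h1, h2, h3, h4⟩ := S.graded.exists_minimal_cover
  exact ⟨⟨k, b, LinearMap.ker f, h3, h4⟩, f, h1, h2, rfl⟩

/-- Every proper homogeneous ideal has a minimal graded free resolution; properness is stated as
`J ⊆ 𝔪`. -/
theorem nonempty_minimalGradedFreeResolution (J : Ideal (MvPolynomial σ K))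
    (hJ : ∀ f ∈ J, ∀ e, homogeneousComponent e f ∈ J) (hJ0 : ∀ f ∈ J, constantCoeff f = 0) :
    Nonempty (MinimalGradedFreeResolution J) := by
  let S₀ : MinimalGradedSubmodule σ K :=
    { rank := 1
      shift := 0
      carrier := Submodule.pi Set.univ fun _ => J
      graded := fun v hv e p _ => by simpa [component] using hJ _ (hv p trivial) e
      minimal := fun v hv p => hJ0 _ (hv p trivial) }
  choose next f hf hr hk using MinimalGradedSubmodule.exists_next (σ := σ) (K := K)
  let S : ℕ → MinimalGradedSubmodule σ K := fun i => Nat.rec S₀ (fun _ T => next T) i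
  refine ⟨{
    rank := fun i => (S i).rank
    shift := fun i => (S i).shift
    d := fun i => f (S i)
    rank_zero := rfl
    shift_zero := fun _ => rfl
    range_d_zero := fun v => ?_
    exact := fun i => ?_
    homogeneous := fun i => hf (S i)
    minimal := fun i q => (S i).minimal _ (hr (S i) ▸ LinearMap.mem_range_self _ _) }⟩
  · rw [hr (S 0)]
    simp [S, S₀, Submodule.mem_pi]
  · rw [LinearMap.exact_iff, hr (S (i + 1)), hk (S i)]
end GradedFree

/-! ### Koszul relations between variables -/

namespace GradedFree

variable {σ K : Type*} [Field K] {ι : Type*}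

section Koszul

/-- The Koszul relation `x_j e_i - x_i e_j` between the variables `x_i = X (f i)`. -/
noncomputable def koszulRelation [DecidableEq ι] (K : Type*) [Field K] (f : ι → σ) (j i : ι) :
    ι → MvPolynomial σ K :=
  (X (f j) : MvPolynomial σ K) • Pi.single i 1 - (X (f i) : MvPolynomial σ K) • Pi.single j 1

/-- The syzygies of distinct variables are generated by the Koszul relations. By induction on the
support `S ∪ {k}` of the syzygy `a`: the coefficient `a k` lies in the ideal generated by the variables
of `S`, so it can be cancelled by Koszul relations. -/
theorem mem_span_koszulRelation [Fintype ι] [DecidableEq ι] {f : ι → σ} (hf : Function.Injective f)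
    (a : ι → MvPolynomial σ K) (ha : ∑ i, a i * X (f i) = 0) :
    a ∈ Submodule.span (MvPolynomial σ K) (Set.range fun q : ι × ι => koszulRelation K f q.1 q.2) := by
  suffices h : ∀ (S : Finset ι) (a : ι → MvPolynomial σ K), (∀ i ∉ S, a i = 0) →
      ∑ i, a i * X (f i) = 0 →
      a ∈ Submodule.span (MvPolynomial σ K)
        (Set.range fun q : ι × ι => koszulRelation K f q.1 q.2) from
    h Finset.univ a (by simp) ha
  intro S
  induction S using Finset.induction_on with
  | empty =>
    intro a h0 _
    rw [show a = 0 from funext fun i => h0 i (by simp)]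
    exact Submodule.zero_mem _
  | insert k S hk ih =>
    intro a h0 ha
    have hsum : a k * X (f k) = -∑ i ∈ S, a i * X (f i) := by
      rw [← add_eq_zero_iff_eq_neg, ← Finset.sum_insert (f := fun i => a i * X (f i)) hk, ← ha]
      exact Finset.sum_subset (Finset.subset_univ _) fun i _ hi => by rw [h0 i hi, zero_mul]
    have hmem : a k * X (f k) ∈ Ideal.span (X '' (f '' S) : Set (MvPolynomial σ K)) := by
      rw [hsum]
      refine neg_mem (sum_mem fun i hi => Ideal.mul_mem_left _ _ (Ideal.subset_span ?_))
      exact ⟨_, ⟨i, hi, rfl⟩, rfl⟩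
    have hak : a k ∈ Ideal.span (X '' (f '' S) : Set (MvPolynomial σ K)) := by
      rw [mem_ideal_span_X_image] at hmem ⊢
      intro u hu
      obtain ⟨_, ⟨i, hi, rfl⟩, hne⟩ := hmem (u + Finsupp.single (f k) 1) (by
        rwa [mem_support_iff, coeff_mul_X, ← mem_support_iff])
      refine ⟨f i, ⟨i, hi, rfl⟩, ?_⟩
      have : f k ≠ f i := fun h => hk (hf h ▸ hi)
      simpa [Finsupp.single_eq_of_ne' this] using hne
    rw [← Set.image_comp, Ideal.span, Submodule.mem_span_image_finset_iff_exists_fun'] at hak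
    obtain ⟨c, hc⟩ := hak
    have hkos : ∀ i ∈ S, c i • koszulRelation K f i k ∈ Submodule.span (MvPolynomial σ K)
        (Set.range fun q : ι × ι => koszulRelation K f q.1 q.2) := fun i _ =>
      Submodule.smul_mem _ _ (Submodule.subset_span ⟨(i, k), rfl⟩)
    rw [← Submodule.sub_mem_iff_left _ (sum_mem hkos)]
    refine ih _ (fun i hi => ?_) ?_
    · by_cases hik : i = k
      · subst hik
        have hne : ∀ j ∈ S, (Pi.single j 1 : ι → MvPolynomial σ K) i = 0 := fun j hj =>
          Pi.single_eq_of_ne (fun h : i = j => hk (h ▸ hj)) _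
        rw [Pi.sub_apply, Finset.sum_apply, sub_eq_zero, ← hc]
        refine Finset.sum_congr rfl fun j hj => ?_
        simp [koszulRelation, hne j hj]
      · rw [Pi.sub_apply, h0 i (by simp [hik, hi]), Finset.sum_apply, Finset.sum_eq_zero, sub_zero]
        intro j hj
        have : i ≠ j := fun h => hi (h ▸ hj)
        simp [koszulRelation, Pi.single_eq_of_ne hik, Pi.single_eq_of_ne this]
    · have hz : ∀ j, ∑ i, koszulRelation K f j k i * X (f i) = 0 := by
        intro j
        simp [koszulRelation, sub_mul, Finset.sum_sub_distrib, Pi.single_apply, mul_comm (X (f j))]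
      simp only [Pi.sub_apply, sub_mul, Finset.sum_sub_distrib, ha, Finset.sum_apply,
        Finset.sum_mul, zero_sub, neg_eq_zero]
      rw [Finset.sum_comm]
      refine Finset.sum_eq_zero fun j _ => ?_
      simp only [Pi.smul_apply, smul_eq_mul, mul_assoc]
      rw [← Finset.mul_sum, hz, mul_zero]

end Koszul

/-! ### The start of the resolution of the initial ideal -/

section Explicit

variable {m : ℕ}

/-- The generators `x_i y` and `s t x_{j+1}` of the initial ideal; chain elements are numbered from 0,
so that the second family omits the least of them. -/
noncomputable def generator (K : Type*) [Field K] (x : Fin (m + 1) → σ) (y s t : σ) :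
    Fin (m + 1) ⊕ Fin m → MvPolynomial σ K
  | .inl i => X (x i) * X y
  | .inr j => X s * X t * X (x j.succ)

/-- The degrees of the generators. -/
def generatorShift (m : ℕ) : Fin (m + 1) ⊕ Fin m → ℕ
  | .inl _ => 2
  | .inr _ => 3

/-- The basis of the second free module: pairs `i < j` of generators `x_i y`, pairs of generators
`s t x_{j+1}`, and one element for each generator `s t x_{j+1}`. -/
abbrev SyzygyIndex (m : ℕ) : Type :=
  ((j : Fin (m + 1)) × {i : Fin (m + 1) // i < j}) ⊕
    (((j : Fin m) × {i : Fin m // i < j}) ⊕ Fin m)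

/-- The syzygies: Koszul relations within each of the two families of generators, and
`y · (s t x_{j+1}) - s t · (x_{j+1} y)`. -/
noncomputable def syzygy (K : Type*) [Field K] (x : Fin (m + 1) → σ) (y s t : σ) :
    SyzygyIndex m → Fin (m + 1) ⊕ Fin m → MvPolynomial σ K
  | .inl q => (X (x q.1) : MvPolynomial σ K) • Pi.single (.inl q.2.1) 1 -
      (X (x q.2.1) : MvPolynomial σ K) • Pi.single (.inl q.1) 1
  | .inr (.inl q) => (X (x q.1.succ) : MvPolynomial σ K) • Pi.single (.inr q.2.1) 1 -
      (X (x q.2.1.succ) : MvPolynomial σ K) • Pi.single (.inr q.1) 1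
  | .inr (.inr j) => (X y : MvPolynomial σ K) • Pi.single (.inr j) 1 -
      (X s * X t : MvPolynomial σ K) • Pi.single (.inl j.succ) 1

/-- The degrees of the syzygies. -/
def syzygyShift (m : ℕ) : SyzygyIndex m → ℕ
  | .inl _ => 3
  | .inr _ => 4

/-- The map from the free module on the generators to `R`. The target is written `ρ → R`, with `ρ`
to be a one-element type, to fit the module `F_0` of an arbitrary resolution. -/
noncomputable def generatorMap (K : Type*) [Field K] (ρ : Type*) (x : Fin (m + 1) → σ) (y s t : σ) :
    (Fin (m + 1) ⊕ Fin m → MvPolynomial σ K) →ₗ[MvPolynomial σ K] (ρ → MvPolynomial σ K) :=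
  Fintype.linearCombination _ fun q _ => generator K x y s t q

/-- The map from the free module on the syzygies to the free module on the generators. -/
noncomputable def syzygyMap (K : Type*) [Field K] (x : Fin (m + 1) → σ) (y s t : σ) :
    (SyzygyIndex m → MvPolynomial σ K) →ₗ[MvPolynomial σ K]
      (Fin (m + 1) ⊕ Fin m → MvPolynomial σ K) :=
  Fintype.linearCombination _ (syzygy K x y s t)

variable {x : Fin (m + 1) → σ} {y s t : σ} {ρ : Type*}

theorem generatorMap_apply (v : Fin (m + 1) ⊕ Fin m → MvPolynomial σ K) (p : ρ) :
    generatorMap K ρ x y s t v p = X y * ∑ i, v (.inl i) * X (x i) +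
      X s * X t * ∑ j, v (.inr j) * X (x (Fin.succ j)) := by
  rw [generatorMap, Fintype.linearCombination_apply, Finset.sum_apply, Fintype.sum_sum_type,
    Finset.mul_sum, Finset.mul_sum]
  simp only [Pi.smul_apply, smul_eq_mul, generator]
  congr 1 <;> exact Finset.sum_congr rfl fun _ _ => by ring

theorem syzygy_mem_range (q : SyzygyIndex m) :
    syzygy K x y s t q ∈ LinearMap.range (syzygyMap K x y s t) :=
  ⟨Pi.single q 1, by rw [syzygyMap, Fintype.linearCombination_apply_single, one_smul]⟩

theorem generatorMap_syzygy (q : SyzygyIndex m) :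
    generatorMap K ρ x y s t (syzygy K x y s t q) = 0 := by
  rcases q with q | q | j <;>
  · simp only [syzygy, map_sub, map_smul]
    simp only [generatorMap, Fintype.linearCombination_apply_single]
    ext1 p
    simp only [generator, Pi.sub_apply, Pi.smul_apply, smul_eq_mul, Pi.zero_apply]
    ring

theorem inl_koszul_mem (a : Fin (m + 1) → MvPolynomial σ K)
    (ha : a ∈ Submodule.span (MvPolynomial σ K)
      (Set.range fun q : Fin (m + 1) × Fin (m + 1) => koszulRelation K x q.1 q.2)) :
    (Sum.elim a 0 : Fin (m + 1) ⊕ Fin m → MvPolynomial σ K) ∈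
      LinearMap.range (syzygyMap K x y s t) := by
  induction ha using Submodule.span_induction with
  | zero => rw [Sum.elim_zero_zero]; exact zero_mem _
  | add a b _ _ ha hb =>
    convert add_mem ha hb using 1
    ext1 (i | i) <;> simp
  | smul c a _ ha =>
    convert Submodule.smul_mem _ c ha using 1
    ext1 (i | i) <;> simp
  | mem a ha =>
    obtain ⟨⟨j, i⟩, rfl⟩ := ha
    have key : ∀ j i : Fin (m + 1), i < j →
        (Sum.elim (koszulRelation K x j i) 0 : Fin (m + 1) ⊕ Fin m → MvPolynomial σ K) ∈
          LinearMap.range (syzygyMap K x y s t) := by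
      intro j i hij
      convert syzygy_mem_range (K := K) (x := x) (y := y) (s := s) (t := t) (.inl ⟨j, i, hij⟩) using 1
      ext1 (k | k) <;> simp [syzygy, koszulRelation, Pi.single_apply]
    rcases lt_trichotomy i j with h | rfl | h
    · exact key j i h
    · convert (zero_mem _ : 0 ∈ LinearMap.range (syzygyMap K x y s t)) using 1
      ext1 (k | k) <;> simp [koszulRelation]
    · convert neg_mem (key i j h) using 1
      ext1 (k | k) <;> simp [koszulRelation]

/-- Every Koszul syzygy of the variables `y` and `x_1`, …, `x_m`, with `y` at `none` and indices counted from 0, agrees, in the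
coordinates of the `x_j`, with the second half of some combination of the `syzygy q`. -/
theorem inr_koszul_mem (a : Option (Fin m) → MvPolynomial σ K)
    (ha : a ∈ Submodule.span (MvPolynomial σ K) (Set.range fun q : Option (Fin m) × Option (Fin m) =>
      koszulRelation K (fun o : Option (Fin m) => o.elim y fun j => x j.succ) q.1 q.2)) :
    ∃ w ∈ LinearMap.range (syzygyMap K x y s t), ∀ j, w (.inr j) = a (some j) := by
  induction ha using Submodule.span_induction with
  | zero => exact ⟨0, zero_mem _, fun _ => rfl⟩
  | add a b _ _ ha hb =>
    obtain ⟨w, hw, hwa⟩ := ha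
    obtain ⟨w', hw', hwb⟩ := hb
    exact ⟨_, add_mem hw hw', fun j => by simp [hwa, hwb]⟩
  | smul c a _ ha =>
    obtain ⟨w, hw, hwa⟩ := ha
    exact ⟨_, Submodule.smul_mem _ c hw, fun j => by simp [hwa]⟩
  | mem a ha =>
    obtain ⟨⟨j, i⟩, rfl⟩ := ha
    have hsymm : ∀ j i, (∃ w ∈ LinearMap.range (syzygyMap K x y s t), ∀ k, w (.inr k) =
        koszulRelation K (fun o : Option (Fin m) => o.elim y fun j => x j.succ) j i (some k)) →
        ∃ w ∈ LinearMap.range (syzygyMap K x y s t), ∀ k, w (.inr k) =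
        koszulRelation K (fun o : Option (Fin m) => o.elim y fun j => x j.succ) i j (some k) := by
      rintro j i ⟨w, hw, h⟩
      exact ⟨-w, neg_mem hw, fun k => by simp [h, koszulRelation]⟩
    have hnone : ∀ i : Fin m, ∃ w ∈ LinearMap.range (syzygyMap K x y s t), ∀ k, w (.inr k) =
        koszulRelation K (fun o : Option (Fin m) => o.elim y fun j => x j.succ) none (some i)
          (some k) := fun i =>
      ⟨_, syzygy_mem_range (.inr (.inr i)), fun k => by
        simp [syzygy, koszulRelation, Pi.single_apply]⟩
    have hsome : ∀ j i : Fin m, i < j → ∃ w ∈ LinearMap.range (syzygyMap K x y s t), ∀ k,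
        w (.inr k) = koszulRelation K (fun o : Option (Fin m) => o.elim y fun j => x j.succ)
          (some j) (some i) (some k) := fun j i hij =>
      ⟨_, syzygy_mem_range (.inr (.inl ⟨j, i, hij⟩)), fun k => by
        simp [syzygy, koszulRelation, Pi.single_apply]⟩
    have hrefl : ∀ i, ∃ w ∈ LinearMap.range (syzygyMap K x y s t), ∀ k, w (.inr k) =
        koszulRelation K (fun o : Option (Fin m) => o.elim y fun j => x j.succ) i i (some k) :=
      fun i => ⟨0, zero_mem _, fun k => by simp [koszulRelation]⟩
    rcases j with _ | j <;> rcases i with _ | i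
    · exact hrefl _
    · exact hnone i
    · exact hsymm _ _ (hnone j)
    · rcases lt_trichotomy i j with h | rfl | h
      · exact hsome j i h
      · exact hrefl _
      · exact hsymm _ _ (hsome i j h)

/-- The syzygies generate all relations. If `y ∑ a_i x_i + s t ∑ b_j x_{j+1} = 0`, then `y` divides
`∑ b_j x_{j+1}`, so that `b` extends to a syzygy of `y` and the `x_{j+1}`. This Koszul syzygy removes
`b`, and then `a` is a syzygy of the `x_i`. -/
theorem exact_syzygyMap_generatorMap [Nonempty ρ] (hx : Function.Injective x) (hxy : ∀ i, x i ≠ y)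
    (hys : y ≠ s) (hyt : y ≠ t) :
    Function.Exact (syzygyMap K x y s t) (generatorMap K ρ x y s t) := by
  have hle : ∀ w, generatorMap K ρ x y s t (syzygyMap K x y s t w) = 0 := by
    intro w
    rw [syzygyMap, Fintype.linearCombination_apply, map_sum]
    exact Finset.sum_eq_zero fun q _ => by rw [map_smul, generatorMap_syzygy, smul_zero]
  intro v
  refine ⟨fun hv => ?_, ?_⟩
  swap
  · rintro ⟨w, rfl⟩
    exact hle w
  obtain ⟨p⟩ := ‹Nonempty ρ›
  have hv0 := congrFun hv p
  rw [generatorMap_apply, Pi.zero_apply] at hv0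
  have hdvd : (X y : MvPolynomial σ K) ∣ ∑ j, v (.inr j) * X (x (Fin.succ j)) := by
    have h1 : (X y : MvPolynomial σ K) ∣ X s * X t * ∑ j, v (.inr j) * X (x (Fin.succ j)) :=
      (dvd_add_right (dvd_mul_right _ _)).1 (hv0 ▸ dvd_zero _)
    rw [X_dvd_mul_iff, X_dvd_mul_iff, X_dvd_X, X_dvd_X] at h1
    tauto
  obtain ⟨c, hc⟩ := hdvd
  have hinj : Function.Injective fun o : Option (Fin m) => o.elim y fun j => x j.succ := by
    rintro (_ | i) (_ | j) h
    · rfl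
    · exact absurd h.symm (hxy _)
    · exact absurd h (hxy _)
    · exact congrArg some (Fin.succ_injective _ (hx h))
  obtain ⟨w, hw, hwv⟩ := inr_koszul_mem (K := K) (x := x) (y := y) (s := s) (t := t)
    (fun o => o.elim (-c) fun j => v (.inr j)) (mem_span_koszulRelation hinj _ (by
      rw [Fintype.sum_option]
      simp only [Option.elim_none, Option.elim_some, hc]
      ring))
  have hvw : generatorMap K ρ x y s t (v - w) = 0 := by
    obtain ⟨w, rfl⟩ := hw
    rw [map_sub, hv, hle, sub_zero]
  have hvw' := congrFun hvw p
  have hr : ∀ j, (v - w) (.inr j) = 0 := fun j => by simp [hwv]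
  rw [generatorMap_apply, Pi.zero_apply] at hvw'
  simp only [hr, zero_mul, Finset.sum_const_zero, mul_zero, add_zero, mul_eq_zero, X_ne_zero,
    false_or] at hvw'
  have hmem := inl_koszul_mem (y := y) (s := s) (t := t) _ (mem_span_koszulRelation hx _ hvw')
  have heq : (Sum.elim (fun i => (v - w) (.inl i)) 0 : Fin (m + 1) ⊕ Fin m → MvPolynomial σ K) =
      v - w := by
    ext1 (i | j)
    · rfl
    · exact (hr j).symm
  rw [heq, Submodule.sub_mem_iff_left _ hw] at hmem
  exact hmem

theorem syzygyMap_isMinimalVec (w : SyzygyIndex m → MvPolynomial σ K) :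
    IsMinimalVec (syzygyMap K x y s t w) := by
  intro p
  rw [syzygyMap, Fintype.linearCombination_apply, Finset.sum_apply, map_sum]
  refine Finset.sum_eq_zero fun q _ => ?_
  rcases q with q | q | j <;> simp [syzygy]

theorem coeff_single_mul {p g : MvPolynomial σ K} (hg : constantCoeff g = 0) (z : σ) :
    coeff (Finsupp.single z 1) (p * g) = constantCoeff p * coeff (Finsupp.single z 1) g := by
  classical
  rw [coeff_mul, Finsupp.antidiagonal_single, Finset.sum_map, Finset.Nat.antidiagonal_succ]
  rw [constantCoeff_eq] at hg
  simp [constantCoeff_eq, hg]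

/-- No relation between the syzygies has a coefficient with nonzero constant term. For each syzygy
`q₀` some variable has coefficient 1 in one coordinate of `syzygy q₀` and coefficient 0 in that
coordinate of all others; comparing coefficients of this variable gives the claim. -/
theorem isMinimalVec_of_syzygyMap_eq_zero (hx : Function.Injective x) (hxy : ∀ i, x i ≠ y)
    (w : SyzygyIndex m → MvPolynomial σ K) (hw : syzygyMap K x y s t w = 0) : IsMinimalVec w := by
  classical
  have key : ∀ (q₀ : SyzygyIndex m) (p : Fin (m + 1) ⊕ Fin m) (z : σ),
      (∀ q, coeff (Finsupp.single z 1) (syzygy K x y s t q p) = if q = q₀ then 1 else 0) →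
      constantCoeff (w q₀) = 0 := by
    intro q₀ p z h
    have h1 := congrArg (coeff (Finsupp.single z 1)) (congrFun hw p)
    rw [syzygyMap, Fintype.linearCombination_apply, Finset.sum_apply, coeff_sum, Pi.zero_apply,
      coeff_zero] at h1
    rw [← h1]
    have h0 : ∀ q, constantCoeff (syzygy K x y s t q p) = 0 := by
      intro q
      rcases q with q | q | j <;> simp [syzygy]
    simp [coeff_single_mul (h0 _), h]
  have hX : ∀ z z' : σ, coeff (Finsupp.single z 1) (X z' : MvPolynomial σ K) =
      if z' = z then 1 else 0 := by
    intro z z'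
    simp [coeff_X, Finsupp.single_left_inj]
  have hst : ∀ z : σ, coeff (Finsupp.single z 1) (X s * X t : MvPolynomial σ K) = 0 := by
    intro z
    rw [coeff_single_mul (constantCoeff_X K t)]; simp
  have hite : ∀ (P : Prop) [Decidable P] (z : σ) (f : MvPolynomial σ K),
      coeff (Finsupp.single z 1) (if P then f else 0) =
        if P then coeff (Finsupp.single z 1) f else 0 := by
    intro P _ z f
    split_ifs <;> simp
  have hxy' := fun i => (hxy i).symm
  rintro (⟨j, i, hij⟩ | ⟨j, i, hij⟩ | j)
  · refine key _ (.inl i) (x j) ?_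
    rintro (⟨j', i', hij'⟩ | ⟨j', i', hij'⟩ | j')
    · simp [syzygy, Pi.single_apply, hite, hX, hx.eq_iff]
      rcases eq_or_ne j' j with rfl | hj
      · simp [hij.ne, eq_comm]
      · simp [hj]
        rintro rfl rfl
        exact lt_asymm hij hij'
    · simp [syzygy]
    · simp [syzygy, Pi.single_apply, hst, hite]
  · refine key _ (.inr i) (x j.succ) ?_
    rintro (⟨j', i', hij'⟩ | ⟨j', i', hij'⟩ | j')
    · simp [syzygy]
    · simp [syzygy, Pi.single_apply, hite, hX, hx.eq_iff]
      rcases eq_or_ne j' j with rfl | hj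
      · simp [hij.ne, eq_comm]
      · simp [hj]
        rintro rfl rfl
        exact lt_asymm hij hij'
    · simp [syzygy, Pi.single_apply, hite, hX, hxy']
  · refine key _ (.inr j) y ?_
    rintro (⟨j', i', hij'⟩ | ⟨j', i', hij'⟩ | j')
    · simp [syzygy]
    · simp [syzygy, Pi.single_apply, hite, hX, hxy]
    · simp [syzygy, Pi.single_apply, hite, hX, eq_comm]

theorem isHomogeneousMap_generatorMap :
    IsHomogeneousMap (generatorShift m) (0 : ρ → ℕ) (generatorMap K ρ x y s t) := by
  intro q p u hu
  rw [generatorMap, Fintype.linearCombination_apply_single, one_smul] at hu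
  have h1 := fun z : σ => isHomogeneous_X K z
  have : (generator K x y s t q).IsHomogeneous (generatorShift m q) := by
    rcases q with i | j
    · exact (h1 _).mul (h1 _)
    · exact ((h1 _).mul (h1 _)).mul (h1 _)
  have := this (mem_support_iff.1 hu)
  rw [Finsupp.degree_eq_weight_one]
  exact this

theorem isHomogeneousVec_smul_single [DecidableEq ι] (a : ι → ℕ) {f : MvPolynomial σ K} {e : ℕ}
    (hf : f.IsHomogeneous e) (q : ι) :
    IsHomogeneousVec a (e + a q) (f • (Pi.single q 1 : ι → MvPolynomial σ K)) := by
  intro p u hu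
  by_cases h : p = q
  · subst h
    rw [Pi.smul_apply, Pi.single_eq_same, smul_eq_mul, mul_one] at hu
    have := hf (mem_support_iff.1 hu)
    rw [Finsupp.degree_eq_weight_one]
    exact congrArg (· + a p) this
  · simp [Pi.single_eq_of_ne h] at hu

theorem isHomogeneousMap_syzygyMap :
    IsHomogeneousMap (syzygyShift m) (generatorShift m) (syzygyMap K x y s t) := by
  intro q
  rw [syzygyMap, Fintype.linearCombination_apply_single, one_smul]
  have h1 := fun z : σ => isHomogeneous_X K z
  rcases q with q | q | j
  · exact (isHomogeneousVec_smul_single (generatorShift m) (h1 _) (.inl _)).sub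
      (isHomogeneousVec_smul_single (generatorShift m) (h1 _) (.inl _))
  · exact (isHomogeneousVec_smul_single (generatorShift m) (h1 _) (.inr _)).sub
      (isHomogeneousVec_smul_single (generatorShift m) (h1 _) (.inr _))
  · exact (isHomogeneousVec_smul_single (generatorShift m) (h1 _) (.inr _)).sub
      (isHomogeneousVec_smul_single (generatorShift m) ((h1 _).mul (h1 _)) (.inl _))

theorem card_sigma_lt (m : ℕ) : Fintype.card ((j : Fin m) × {i : Fin m // i < j}) = m.choose 2 := by
  rw [Fintype.card_sigma]
  simp only [Fintype.card_subtype, Finset.filter_gt_eq_Iio, Fin.card_Iio]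
  rw [Fin.sum_univ_eq_sum_range (fun i => i), Finset.sum_range_id, Nat.choose_two_right]

end Explicit
end GradedFree

/-! ### The initial ideal -/

namespace TwoChain

open CrystalLattice

variable {K : Type*} [Field K] {m : ℕ}

/-- The element `x_i` of the chain of `L_2(m + 1, 1)`, with indices counted from 0. -/
abbrev chain (i : Fin (m + 1)) : CrystalLattice ![m + 1, 1] := .x 0 i

/-- The element `y` of `L_2(m + 1, 1)`, which is incomparable to the chain. -/
abbrev point (m : ℕ) : CrystalLattice ![m + 1, 1] := .x 1 (0 : Fin 1)

theorem cases_eq (c : CrystalLattice ![m + 1, 1]) :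
    c = .s ∨ (∃ i, c = chain i) ∨ c = point m ∨ c = .t := by
  rcases c with _ | ⟨i, a⟩ | _
  · exact .inl rfl
  · match i, a with
    | 0, a => exact .inr (.inl ⟨a, rfl⟩)
    | 1, a => exact .inr (.inr (.inl (congrArg (CrystalLattice.x 1) (Subsingleton.elim (α := Fin 1) a 0))))
  · exact .inr (.inr (.inr rfl))

theorem chain_injective : Function.Injective (chain (m := m)) := by
  intro i j h
  injection h

theorem chain_ne_point (i : Fin (m + 1)) : chain i ≠ point m := by
  intro h
  injection h with h
  exact absurd h (by decide)

theorem chain_sup_point (i : Fin (m + 1)) : chain i ⊔ point m = .t := rfl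
theorem chain_inf_point (i : Fin (m + 1)) : chain i ⊓ point m = .s := rfl

/-- The binomial `x_i y - s t`. -/
noncomputable def binomial (K : Type*) [Field K] (i : Fin (m + 1)) :
    MvPolynomial (CrystalLattice ![m + 1, 1]) K :=
  X (chain i) * X (point m) - X .s * X .t

theorem joinMeetIdeal_eq : joinMeetIdeal K (CrystalLattice ![m + 1, 1]) =
    Ideal.span (Set.range (binomial (m := m) K)) := by
  refine le_antisymm (Ideal.span_le.2 ?_) (Ideal.span_mono ?_)
  · rintro _ ⟨a, b, rfl⟩
    have hle : ∀ a b : CrystalLattice ![m + 1, 1], a ≤ b →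
        (X a * X b - X (a ⊔ b) * X (a ⊓ b) : MvPolynomial (CrystalLattice ![m + 1, 1]) K) ∈
          Ideal.span (Set.range (binomial (m := m) K)) := by
      intro a b h
      rw [sup_eq_right.2 h, inf_eq_left.2 h, mul_comm, sub_self]
      exact zero_mem _
    have hge : ∀ a b : CrystalLattice ![m + 1, 1], b ≤ a →
        (X a * X b - X (a ⊔ b) * X (a ⊓ b) : MvPolynomial (CrystalLattice ![m + 1, 1]) K) ∈
          Ideal.span (Set.range (binomial (m := m) K)) := by
      intro a b h
      rw [mul_comm, sup_comm, inf_comm]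
      exact hle b a h
    have hs : ∀ a : CrystalLattice ![m + 1, 1], .s ≤ a := fun a => trivial
    have ht : ∀ a : CrystalLattice ![m + 1, 1], a ≤ .t := fun a => by cases a <;> trivial
    have hcp : ∀ i : Fin (m + 1), (X (chain i) * X (point m) - X (chain i ⊔ point m) *
        X (chain i ⊓ point m) : MvPolynomial (CrystalLattice ![m + 1, 1]) K) ∈
          Ideal.span (Set.range (binomial (m := m) K)) := fun i => by
      rw [chain_sup_point, chain_inf_point, mul_comm (X CrystalLattice.t)]
      exact Ideal.subset_span ⟨i, rfl⟩
    rcases cases_eq a with rfl | ⟨i, rfl⟩ | rfl | rfl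
    · exact hle _ _ (hs _)
    · rcases cases_eq b with rfl | ⟨j, rfl⟩ | rfl | rfl
      · exact hge _ _ (hs _)
      · rcases le_total i j with h | h
        · exact hle _ _ ⟨rfl, h⟩
        · exact hge _ _ ⟨rfl, h⟩
      · exact hcp i
      · exact hle _ _ (ht _)
    · rcases cases_eq b with rfl | ⟨j, rfl⟩ | rfl | rfl
      · exact hge _ _ (hs _)
      · rw [SetLike.mem_coe, mul_comm, sup_comm, inf_comm]
        exact hcp j
      · exact hle _ _ le_rfl
      · exact hle _ _ (ht _)
    · exact hge _ _ (ht _)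
  · rintro _ ⟨i, rfl⟩
    refine ⟨chain i, point m, ?_⟩
    rw [chain_sup_point, chain_inf_point, binomial, mul_comm (X CrystalLattice.s)]

/-- The linear functional that adds up the coefficients of the monomials in the class `P`. -/
noncomputable def classSum {σ : Type*} (K : Type*) [Field K] (P : (σ →₀ ℕ) → Prop) [DecidablePred P] :
    MvPolynomial σ K →ₗ[K] K :=
  (basisMonomials σ K).constr K fun u => if P u then 1 else 0

theorem classSum_monomial {σ : Type*} (P : (σ →₀ ℕ) → Prop) [DecidablePred P] (u : σ →₀ ℕ) :
    classSum K P (monomial u 1) = if P u then 1 else 0 := by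
  rw [← Module.Basis.constr_basis (basisMonomials σ K) K (fun u => if P u then (1 : K) else 0) u,
    coe_basisMonomials, classSum]

theorem classSum_apply {σ : Type*} (P : (σ →₀ ℕ) → Prop) [DecidablePred P] (f : MvPolynomial σ K) :
    classSum K P f = ∑ u ∈ f.support, if P u then coeff u f else 0 := by
  conv_lhs => rw [f.as_sum, map_sum]
  refine Finset.sum_congr rfl fun u _ => ?_
  rw [← mul_one (coeff u f), ← smul_eq_mul, ← smul_monomial, map_smul, classSum_monomial]
  simp

/-- If the class `P` is invariant under replacing `x_i y` by `s t`, its functional vanishes on the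
join-meet ideal. -/
theorem classSum_eq_zero (P : (CrystalLattice ![m + 1, 1] →₀ ℕ) → Prop) [DecidablePred P]
    (hP : ∀ u i, P (u + (Finsupp.single (chain i) 1 + Finsupp.single (point m) 1)) ↔
      P (u + (Finsupp.single .s 1 + Finsupp.single .t 1)))
    {f : MvPolynomial (CrystalLattice ![m + 1, 1]) K}
    (hf : f ∈ joinMeetIdeal K (CrystalLattice ![m + 1, 1])) : classSum K P f = 0 := by
  rw [joinMeetIdeal_eq] at hf
  suffices h : ∀ r, classSum K P (r * f) = 0 by simpa using h 1
  induction hf using Submodule.span_induction with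
  | zero => simp
  | add a b _ _ ha hb => intro r; rw [mul_add, map_add, ha, hb, add_zero]
  | smul c a _ ha => intro r; rw [smul_eq_mul, ← mul_assoc, ha]
  | mem g hg =>
    obtain ⟨i, rfl⟩ := hg
    have : classSum K P ∘ₗ LinearMap.mulRight K (binomial K i) = 0 := by
      refine (basisMonomials _ K).ext fun u => ?_
      simp only [coe_basisMonomials, LinearMap.comp_apply, LinearMap.mulRight_apply, binomial, X,
        monomial_mul, mul_sub, map_sub, mul_one, classSum_monomial, hP, sub_self,
        LinearMap.zero_apply]
    exact fun r => LinearMap.congr_fun this r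

/-- The reverse lexicographic order in which the initial ideal is taken. -/
noncomputable abbrev order (m : ℕ) : MonomialOrder (CrystalLattice ![m + 1, 1]) :=
  @degRevLex (CrystalLattice ![m + 1, 1]) (CrystalLattice.varOrder _) inferInstance

theorem lt_iff {a b : CrystalLattice ![m + 1, 1] →₀ ℕ} : (order m).toSyn a < (order m).toSyn b ↔
    a.degree < b.degree ∨
      a.degree = b.degree ∧ ∃ i, (∀ j, varKey j < varKey i → a j = b j) ∧ b i < a i :=
  @DegRevLex.lt_iff _ (CrystalLattice.varOrder _) a b

theorem not_varKey_lt_s (c : CrystalLattice ![m + 1, 1]) : ¬ varKey c < varKey (.s : CrystalLattice ![m + 1, 1]) := by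
  rcases c with _ | ⟨i, a⟩ | _ <;> simp [varKey, Prod.Lex.toLex_lt_toLex]

theorem eq_s_of_varKey_lt {c : CrystalLattice ![m + 1, 1]} (h : varKey c < varKey (chain (0 : Fin (m + 1)))) :
    c = .s := by
  rcases c with _ | ⟨i, a⟩ | _ <;> simp [varKey, Prod.Lex.toLex_lt_toLex] at h ⊢

theorem degree_eq (u : CrystalLattice ![m + 1, 1] →₀ ℕ) :
    u.degree = u .s + ∑ i, u (chain i) + u (point m) + u .t := by
  let D : (CrystalLattice ![m + 1, 1] →₀ ℕ) →+ ℕ :=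
    Finsupp.applyAddHom .s + ∑ i : Fin (m + 1), Finsupp.applyAddHom (chain i) +
      Finsupp.applyAddHom (point m) + Finsupp.applyAddHom .t
  have : Finsupp.degree = D := by
    classical
    refine Finsupp.addHom_ext fun c k => ?_
    rcases cases_eq c with rfl | ⟨i, rfl⟩ | rfl | rfl <;>
      simp [D, Finsupp.single_apply, chain_injective.eq_iff, chain_ne_point, (chain_ne_point _).symm]
  rw [this]
  simp [D]

/-- Leading monomials of the join-meet ideal are divisible by `x_i y` or by `s t x_{j+1}`. Otherwise
the leading monomial `w` of `f` would be the least element of a class of monomials that is invariant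
under replacing `x_i y` by `s t`, and the functional of this class, which vanishes at `f`, would take
the leading coefficient of `f` as its value. -/
theorem exists_le_degree {f : MvPolynomial (CrystalLattice ![m + 1, 1]) K}
    (hf : f ∈ joinMeetIdeal K (CrystalLattice ![m + 1, 1])) (hf0 : f ≠ 0) :
    (∃ i, Finsupp.single (chain i) 1 + Finsupp.single (point m) 1 ≤ (order m).degree f) ∨
    ∃ j : Fin m, Finsupp.single .s 1 + Finsupp.single .t 1 + Finsupp.single (chain j.succ) 1 ≤
      (order m).degree f := by
  classical
  by_contra! hcon
  set w := (order m).degree f with hw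
  have hw1 : ∀ i, w (chain i) = 0 ∨ w (point m) = 0 := by
    intro i
    by_contra! h
    refine hcon.1 i fun c => ?_
    rcases cases_eq c with rfl | ⟨j, rfl⟩ | rfl | rfl <;>
      simp [Finsupp.single_apply, chain_ne_point, chain_injective.eq_iff]
    · split_ifs with hij
      · subst hij
        omega
      · omega
    · omega
  have hw2 : ∀ j : Fin m, w .s = 0 ∨ w .t = 0 ∨ w (chain j.succ) = 0 := by
    intro j
    by_contra! h
    refine hcon.2 j fun c => ?_
    rcases cases_eq c with rfl | ⟨i, rfl⟩ | rfl | rfl <;>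
      simp [Finsupp.single_apply, chain_ne_point, chain_injective.eq_iff]
    · omega
    · split_ifs with hij
      · subst hij
        omega
      · omega
    · omega
  suffices h : ∃ P : (CrystalLattice ![m + 1, 1] →₀ ℕ) → Prop,
      (∀ u i, P (u + (Finsupp.single (chain i) 1 + Finsupp.single (point m) 1)) ↔
        P (u + (Finsupp.single .s 1 + Finsupp.single .t 1))) ∧ P w ∧
      ∀ u, P u → u = w ∨ (order m).toSyn w < (order m).toSyn u by
    obtain ⟨P, hP, hPw, hPlt⟩ := h
    have h0 := classSum_eq_zero P hP hf
    rw [classSum_apply, Finset.sum_eq_single w, if_pos hPw, hw] at h0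
    · exact (order m).coeff_degree_ne_zero_iff.2 hf0 h0
    · intro u hu huw
      refine if_neg fun hPu => ?_
      rcases hPlt u hPu with h | h
      · exact huw h
      · exact absurd ((order m).le_degree hu) (not_le.2 h)
    · intro h
      exact absurd ((order m).degree_mem_support hf0) h
  by_cases hA : w (point m) = 0 ∧ (w .s = 0 ∨ w .t = 0)
  -- no replacement applies to `w`, in either direction
  · refine ⟨fun u => u = w, fun u i => iff_of_false ?_ ?_, rfl, fun u hu => .inl hu⟩
    · intro h
      have := DFunLike.congr_fun h (point m)
      simp [hA.1] at this
    · intro h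
      have h1 := DFunLike.congr_fun h .s
      have h2 := DFunLike.congr_fun h .t
      rcases hA.2 with h3 | h3 <;> simp [h3] at h1 h2
  · have hx : ∀ j : Fin m, w (chain j.succ) = 0 := by
      intro j
      have h1 := hw1 j.succ
      have h2 := hw2 j
      tauto
    have hx0 := hw1 0
    have hwsum : ∑ i, w (chain i) = w (chain 0) := by
      rw [Fin.sum_univ_succ]; simp [hx]
    -- the class is given by the multidegree for which `x_i`, `y`, `s`, `t` have the degrees
    -- `α + γ`, `β + δ`, `α + β`, `γ + δ`: all `x_i` have the same degree, and `x_i y` that of `s t`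
    refine ⟨fun u => (∑ i, u (chain i)) + u .s = (∑ i, w (chain i)) + w .s ∧
      u (point m) + u .s = w (point m) + w .s ∧
      (∑ i, u (chain i)) + u .t = (∑ i, w (chain i)) + w .t ∧
      u (point m) + u .t = w (point m) + w .t, fun u i => ?_, ⟨rfl, rfl, rfl, rfl⟩, ?_⟩
    · simp only [Finsupp.add_apply, Finset.sum_add_distrib, Finsupp.single_apply,
        chain_injective.eq_iff, chain_ne_point, (chain_ne_point _).symm]
      simp
      omega
    · rintro u ⟨h1, h2, h3, h4⟩
      rw [lt_iff, degree_eq, degree_eq]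
      rw [or_iff_not_imp_right]
      intro hnlt
      have hdeg : w .s + ∑ i, w (chain i) + w (point m) + w .t =
        u .s + ∑ i, u (chain i) + u (point m) + u .t := by omega
      have hs : u .s = w .s := by
        by_contra hne
        exact hnlt (.inr ⟨hdeg, .s, fun j hj => absurd hj (not_varKey_lt_s j), by omega⟩)
      have hu0 : u (chain 0) ≤ ∑ i, u (chain i) :=
        Finset.single_le_sum (f := fun i => u (chain i)) (fun _ _ => Nat.zero_le _)
          (Finset.mem_univ 0)
      have hc : u (chain 0) = w (chain 0) := by
        by_contra hne
        exact hnlt (.inr ⟨hdeg, chain 0, fun j hj => by rw [eq_s_of_varKey_lt hj, hs], by omega⟩)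
      have husum : ∑ j : Fin m, u (chain j.succ) = 0 := by
        have := Fin.sum_univ_succ fun i => u (chain i)
        omega
      rw [Finset.sum_eq_zero_iff] at husum
      ext c
      rcases cases_eq c with rfl | ⟨i, rfl⟩ | rfl | rfl
      · exact hs
      · induction i using Fin.cases with
        | zero => exact hc
        | succ j => rw [hx, husum j (Finset.mem_univ j)]
      · omega
      · omega

theorem leadingTerm_monomial_sub {a b : CrystalLattice ![m + 1, 1] →₀ ℕ}
    (h : (order m).toSyn b < (order m).toSyn a) :
    (order m).leadingTerm (monomial a (1 : K) - monomial b 1) = monomial a 1 := by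
  classical
  have h' : (order m).toSyn ((order m).degree (monomial b (1 : K))) <
      (order m).toSyn ((order m).degree (monomial a (1 : K))) := by
    simpa [MonomialOrder.degree_monomial] using h
  rw [MonomialOrder.leadingTerm, MonomialOrder.degree_sub_of_lt h',
    MonomialOrder.leadingCoeff_sub_of_lt h', MonomialOrder.degree_monomial,
    MonomialOrder.leadingCoeff_monomial, if_neg one_ne_zero]

open GradedFree in
theorem crystalInitialIdeal_eq : crystalInitialIdeal K ![m + 1, 1] =
    Ideal.span (Set.range (generator K (chain (m := m)) (point m) .s .t)) := by
  refine le_antisymm (Ideal.span_le.2 ?_) (Ideal.span_le.2 ?_)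
  · rintro _ ⟨f, hf, rfl⟩
    rw [SetLike.mem_coe]
    change (order m).leadingTerm f ∈ _
    by_cases hf0 : f = 0
    · rw [hf0, MonomialOrder.leadingTerm_zero]
      exact zero_mem _
    have hdvd : ∀ (v w : CrystalLattice ![m + 1, 1] →₀ ℕ) (c : K), v ≤ w →
        (monomial v 1 : MvPolynomial _ K) ∣ monomial w c := fun v w c h =>
      ⟨monomial (w - v) c, by rw [monomial_mul, one_mul, add_tsub_cancel_of_le h]⟩
    rcases exists_le_degree hf hf0 with ⟨i, hi⟩ | ⟨j, hj⟩
    · refine Ideal.mem_of_dvd _ (hdvd _ _ _ hi) (Ideal.subset_span ⟨.inl i, ?_⟩)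
      simp [generator, X, monomial_mul]
    · refine Ideal.mem_of_dvd _ (hdvd _ _ _ hj) (Ideal.subset_span ⟨.inr j, ?_⟩)
      simp [generator, X, monomial_mul]
  · rintro _ ⟨i | j, rfl⟩
    · refine Ideal.subset_span ⟨binomial K i, ?_, ?_⟩
      · rw [joinMeetIdeal_eq]
        exact Ideal.subset_span ⟨i, rfl⟩
      · simp only [binomial, generator, X, monomial_mul, mul_one]
        refine leadingTerm_monomial_sub (lt_iff.2 (.inr ⟨by simp, .s, ?_, by simp⟩))
        exact fun j hj => absurd hj (not_varKey_lt_s j)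
    · refine Ideal.subset_span ⟨X .s * X .t * X (chain j.succ) - X .s * X .t * X (chain 0), ?_, ?_⟩
      · have : (X .s * X .t * X (chain j.succ) - X .s * X .t * X (chain 0) :
            MvPolynomial (CrystalLattice ![m + 1, 1]) K) =
            X (chain 0) * binomial K j.succ - X (chain j.succ) * binomial K 0 := by
          simp only [binomial]; ring
        rw [this, joinMeetIdeal_eq]
        exact sub_mem (Ideal.mul_mem_left _ _ (Ideal.subset_span ⟨_, rfl⟩))
          (Ideal.mul_mem_left _ _ (Ideal.subset_span ⟨_, rfl⟩))
      · simp only [generator, X, monomial_mul, mul_one]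
        refine leadingTerm_monomial_sub (lt_iff.2 (.inr ⟨by simp, chain 0, ?_, ?_⟩))
        · intro c hc
          rw [eq_s_of_varKey_lt hc]
          simp
        · simp [chain_injective.eq_iff, Fin.succ_ne_zero]

end TwoChain

/-! ### Graded Betti numbers -/

namespace GradedFree

variable {σ K : Type*} [Field K] {m : ℕ} {x : Fin (m + 1) → σ} {y s t : σ} {ρ : Type*}

theorem mem_range_generatorMap [Unique ρ] (v : ρ → MvPolynomial σ K) :
    v ∈ LinearMap.range (generatorMap K ρ x y s t) ↔
      ∀ p, v p ∈ Ideal.span (Set.range (generator K x y s t)) := by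
  rw [Unique.forall_iff, Ideal.mem_span_range_iff_exists_fun, LinearMap.mem_range]
  refine exists_congr fun c => ?_
  rw [generatorMap, Fintype.linearCombination_apply, funext_iff, Unique.forall_iff,
    Finset.sum_apply]
  rfl

theorem homogeneousComponent_mem {f : MvPolynomial σ K}
    (hf : f ∈ Ideal.span (Set.range (generator K x y s t))) (e : ℕ) :
    homogeneousComponent e f ∈ Ideal.span (Set.range (generator K x y s t)) := by
  obtain ⟨v, hv⟩ := (mem_range_generatorMap (ρ := Unit) fun _ => f).2 fun _ => hf
  have h := (mem_range_generatorMap (K := K) (x := x) (y := y) (s := s) (t := t) _).1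
    ⟨component (generatorShift m) e v, rfl⟩ ()
  rw [(isHomogeneousMap_generatorMap (ρ := Unit)).map_component, hv] at h
  simpa [component] using h

theorem constantCoeff_eq_zero_of_mem {f : MvPolynomial σ K}
    (hf : f ∈ Ideal.span (Set.range (generator K x y s t))) : constantCoeff f = 0 := by
  obtain ⟨c, rfl⟩ := Ideal.mem_span_range_iff_exists_fun.1 hf
  rw [map_sum]
  refine Finset.sum_eq_zero fun q _ => ?_
  rcases q with i | j <;> simp [generator]

theorem card_generatorShift (m j : ℕ) :
    (Finset.univ.filter fun q => generatorShift m q = j).card =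
      if j = 2 then m + 1 else if j = 3 then m else 0 := by
  rw [Finset.card_filter, Fintype.sum_sum_type]
  by_cases h2 : j = 2
  · subst h2; simp [generatorShift]
  by_cases h3 : j = 3
  · subst h3; simp [generatorShift]
  simp [generatorShift, h2, h3, eq_comm]

theorem card_syzygyShift (m j : ℕ) :
    (Finset.univ.filter fun q => syzygyShift m q = j).card =
      if j = 3 then (m + 1).choose 2 else if j = 4 then m.choose 2 + m else 0 := by
  rw [Finset.card_filter, Fintype.sum_sum_type]
  by_cases h2 : j = 3
  · subst h2
    simp only [syzygyShift]
    simp [-Fintype.card_sigma, card_sigma_lt]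
  by_cases h3 : j = 4
  · subst h3
    simp only [syzygyShift]
    simp [-Fintype.card_sigma, card_sigma_lt]
  simp [syzygyShift, h2, h3, eq_comm]

end GradedFree

namespace MinimalGradedFreeResolution

open GradedFree

variable {σ K : Type*} [Field K] {J : Ideal (MvPolynomial σ K)} (F : MinimalGradedFreeResolution J)

theorem isMinimalVec_d (i : ℕ) (v : Fin (F.rank (i + 1)) → MvPolynomial σ K) :
    IsMinimalVec (F.d i v) := by
  intro p
  rw [map_eq_sum_single (F.d i) v, Finset.sum_apply, map_sum]
  exact Finset.sum_eq_zero fun q _ => by simp [F.minimal i q p]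

theorem isMinimalVec_of_d_eq_zero (i : ℕ) (v : Fin (F.rank (i + 1)) → MvPolynomial σ K)
    (hv : F.d i v = 0) : IsMinimalVec v := by
  obtain ⟨w, rfl⟩ := (F.exact i v).1 hv
  exact F.isMinimalVec_d _ w

theorem shift_zero_eq : F.shift 0 = 0 := funext F.shift_zero

theorem nonempty_rank_zero : Nonempty (Fin (F.rank 0)) := by
  rw [F.rank_zero]; exact ⟨0⟩

end MinimalGradedFreeResolution

namespace GradedFree

variable {σ K : Type*} [Field K] {m : ℕ} {x : Fin (m + 1) → σ} {y s t : σ}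
  (F : MinimalGradedFreeResolution (Ideal.span (Set.range (generator K x y s t))))

theorem range_d_zero_eq : LinearMap.range (F.d 0) =
    LinearMap.range (generatorMap K (Fin (F.rank 0)) x y s t) := by
  have : Unique (Fin (F.rank 0)) := (finCongr F.rank_zero).unique
  ext v
  rw [F.range_d_zero, mem_range_generatorMap]

theorem betti_one (hx : Function.Injective x) (hxy : ∀ i, x i ≠ y) (hys : y ≠ s) (hyt : y ≠ t)
    (j : ℕ) : F.betti 1 j = if j = 2 then m + 1 else if j = 3 then m else 0 := by
  have := F.nonempty_rank_zero
  have hF : IsHomogeneousMap (F.shift 1) 0 (F.d 0) := F.shift_zero_eq ▸ F.homogeneous 0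
  have hG := isHomogeneousMap_generatorMap (K := K) (ρ := Fin (F.rank 0)) (x := x) (y := y)
    (s := s) (t := t)
  rw [← card_generatorShift]
  refine le_antisymm
    (card_shift_le_of_presentation hF hG (range_d_zero_eq F) (F.isMinimalVec_of_d_eq_zero 0) j)
    (card_shift_le_of_presentation hG hF (range_d_zero_eq F).symm (fun v hv => ?_) j)
  obtain ⟨w, rfl⟩ := (exact_syzygyMap_generatorMap hx hxy hys hyt v).1 hv
  exact syzygyMap_isMinimalVec w

theorem betti_two (hx : Function.Injective x) (hxy : ∀ i, x i ≠ y) (hys : y ≠ s) (hyt : y ≠ t)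
    (j : ℕ) : F.betti 2 j =
      if j = 3 then (m + 1).choose 2 else if j = 4 then m.choose 2 + m else 0 := by
  have := F.nonempty_rank_zero
  have hF : IsHomogeneousMap (F.shift 1) 0 (F.d 0) := F.shift_zero_eq ▸ F.homogeneous 0
  have hG := isHomogeneousMap_generatorMap (K := K) (ρ := Fin (F.rank 0)) (x := x) (y := y)
    (s := s) (t := t)
  have hGe := exact_syzygyMap_generatorMap (K := K) (ρ := Fin (F.rank 0)) hx hxy hys hyt
  rw [← card_syzygyShift]
  exact le_antisymm
    (card_shift_le_of_resolution (F.homogeneous 1) hF isHomogeneousMap_syzygyMap hG (F.exact 0) hGe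
      (range_d_zero_eq F) (F.isMinimalVec_d 1) (F.isMinimalVec_of_d_eq_zero 1) j)
    (card_shift_le_of_resolution isHomogeneousMap_syzygyMap hG (F.homogeneous 1) hF hGe (F.exact 0)
      (range_d_zero_eq F).symm syzygyMap_isMinimalVec
      (isMinimalVec_of_syzygyMap_eq_zero hx hxy) j)

end GradedFree

theorem hasSum_of_eq_ite {f : ℕ → ℕ} {a b A B : ℕ} (hab : b ≠ a)
    (hf : ∀ j, f j = if j = a then A else if j = b then B else 0) :
    HasSum (fun j => f j) (f a + f b) := by
  rw [← Finset.sum_pair hab.symm]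
  refine hasSum_sum_of_ne_finset_zero fun j hj => ?_
  simp only [Finset.mem_insert, Finset.mem_singleton, not_or] at hj
  rw [hf, if_neg hj.1, if_neg hj.2]

theorem choose_two_add (m : ℕ) : (m + 1).choose 2 + (m.choose 2 + m) = (m + 1) * m := by
  have h1 : (m + 1).choose 2 = m + m.choose 2 := by
    rw [Nat.choose_succ_succ' m 1, Nat.choose_one_right]
  rw [Nat.choose_two_right, Nat.add_sub_cancel] at h1 ⊢
  have h2 : 2 ∣ (m + 1) * m := mul_comm m (m + 1) ▸ (Nat.even_mul_succ_self m).two_dvd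
  omega

open GradedFree TwoChain in
/-- The graded Betti numbers `B_{1,j}` and `B_{2,j}` of `R / in_<(I_L)` for `L = L_2(n₁, 1)`: a minimal
graded free resolution exists, and every such resolution has the stated Betti numbers. -/
theorem theorem1p1 (K : Type*) [Field K] (n₁ : ℕ) (hn : 2 ≤ n₁) :
    Nonempty (MinimalGradedFreeResolution (crystalInitialIdeal K ![n₁, 1])) ∧
    ∀ F : MinimalGradedFreeResolution (crystalInitialIdeal K ![n₁, 1]),
      (F.betti 1 2 = n₁ ∧
        F.betti 1 3 = n₁ - 1 ∧
        F.betti 2 3 = n₁.choose 2 ∧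
        F.betti 2 4 = (n₁ - 1).choose 2 + (n₁ - 1)) ∧
      (HasSum (fun j => F.betti 1 j) (F.betti 1 2 + F.betti 1 3) ∧
        F.betti 1 2 + F.betti 1 3 = 2 * n₁ - 1) ∧
      (HasSum (fun j => F.betti 2 j) (F.betti 2 3 + F.betti 2 4) ∧
        F.betti 2 3 + F.betti 2 4 = n₁ * (n₁ - 1)) := by
  obtain ⟨m, rfl⟩ : ∃ m, n₁ = m + 1 := ⟨n₁ - 1, by omega⟩
  rw [crystalInitialIdeal_eq]
  refine ⟨nonempty_minimalGradedFreeResolution _ (fun f hf => homogeneousComponent_mem hf)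
    fun f hf => constantCoeff_eq_zero_of_mem hf, fun F => ?_⟩
  have h1 := betti_one F chain_injective chain_ne_point nofun nofun
  have h2 := betti_two F chain_injective chain_ne_point nofun nofun
  refine ⟨⟨by simp [h1], by simp [h1], by simp [h2], by simp [h2]⟩,
    ⟨hasSum_of_eq_ite (by norm_num) h1, ?_⟩, ⟨hasSum_of_eq_ite (by norm_num) h2, ?_⟩⟩
  · simp [h1]
    omega
  · simpa [h2] using choose_two_add m
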